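/- **Theorem 8.1.** Let $(M,g)$ be a smooth Riemannian manifold of dimension $n\ge 2$, with Levi-Civita connection $\nabla$ and Christoffel symbols $\Gamma^k_{ij}$. Write $(x,v)$ for natural coordinates on $TM$ and $|v|$ for the $g$-length of $v$; indices are raised and lowered with $g$. A (smooth, real) function $X$ on $TM$ minus its zero section is called *fiberwise spherically symmetric* if $X=X(x,|v|)$; then $X'$ denotes its derivative in the last argument $|v|$. For any such scalar put $\nabla_sX=\frac{\partial X}{\partial x^s}-\sum_{a,b}v^a\Gamma^b_{sa}\frac{\partial X}{\partial v^b}$. The Newtonian system with force field $F=F(x,v)$ is $\dot x^k=v^k$, $\nabla_tv^k=F^k$, where $\nabla_tv^k=\dot v^k+\sum_{i,j}\Gamma^k_{ij}v^iv^j$; equivalently it is given by the vector field $\sum_k v^k\frac{\partial}{\partial x^k}+\sum_k\Phi^k\frac{\partial}{\partial v^k}$ with $\Phi^k=F^k-\sum_{i,j}\Gamma^k_{ij}v^iv^j$. A *Lagrangian structure* for it is a smooth function $L$ on $TM$ minus the zero section which is regular, $\det\big(\partial^2L/\partial v^i\partial v^j\big)\ne0$ for all $v\neq 0$, and whose Euler–Lagrange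 equations are satisfied by the system: $$\sum_s\frac{\partial^2L}{\partial v^k\partial v^s}\,\Phi^s+\sum_s\frac{\partial^2L}{\partial v^k\partial x^s}\,v^s-\frac{\partial L}{\partial x^k}=0\qquad(k=1,\dots,n,\ v\ne0).$$ (i) Let $W$ be a smooth fiberwise spherically symmetric function on $TM$ minus the zero section, with $W'\neq0$ everywhere. The Newtonian system with force field $$F_r=-|v|\sum_{s}\frac{\nabla_sW}{W'}\Big(\frac{2\,v^sv_r}{|v|^2}-\delta^s_r\Big)\qquad(v\neq0)\tag{8.10}$$ admits a Lagrangian structure with a fiberwise spherically symmetric Lagrange function $L$ if and only if there is a smooth function $f$ on $M$ such that $$F_r=-|v|^2\,\nabla_rf+2\Big(\sum_s\nabla_sf\,v^s\Big)v_r\qquad(v\ne0).\tag{8.18}$$ (ii) For every smooth function $f$ on $M$, the force field (8.18) is the special case $W=|v|\,e^{-f}$ of (8.10) (this $W$ is smooth for $v\ne0$, fiberwise spherically symmetric, and has $W'\neq0$). The Newtonian vector field with force field (8.18), extended by the same formula to $v=0$, coincides with the geodesic vector field of the conformally equivalent metric $e^{-2f}g$, and its trajectories are exactly the (affinely parametrised)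 geodesics of $e^{-2f}g$. -/

import Mathlib

open scoped Manifold ContDiff

namespace NewtonLagrange

noncomputable section

variable {n : ℕ} {M : Type*} [TopologicalSpace M]
  [ChartedSpace (EuclideanSpace ℝ (Fin n)) M] [IsManifold (𝓡 n) ∞ M]

/-- A smooth Riemannian metric on the `n`-dimensional smooth manifold `M`. -/
abbrev Metric (n : ℕ) (M : Type*) [TopologicalSpace M]
    [ChartedSpace (EuclideanSpace ℝ (Fin n)) M] [IsManifold (𝓡 n) ∞ M] :=
  Bundle.ContMDiffRiemannianMetric (𝓡 n) ∞ (EuclideanSpace ℝ (Fin n))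
    (TangentSpace (𝓡 n) : M → Type)

/-- The coordinate vector `e_i` of `ℝⁿ`. -/
abbrev e (i : Fin n) : EuclideanSpace ℝ (Fin n) := EuclideanSpace.single i 1

/-- The component `v^k` of a vector tangent at `p`, in the preferred chart at `p`.  (Mathlib
identifies `T_pM` with `ℝⁿ` by the differential of that chart.) -/
def comp {p : M} (v : TangentSpace (𝓡 n) p) (k : Fin n) : ℝ :=
  (show EuclideanSpace ℝ (Fin n) from v) k

/-- The vector tangent at `p` with given components in the preferred chart at `p`. -/
def ofComp (p : M) (a : Fin n → ℝ) : TangentSpace (𝓡 n) p :=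
  (show EuclideanSpace ℝ (Fin n) from WithLp.toLp 2 a)

/-! ### Natural coordinates

Tensors at a point `p` are given by their components in the preferred chart `φ` at `p`, and all
coordinate derivatives at `p` or at `(p, v)` are taken in this chart.  The quantities defined
by such formulas below (gradients, Euler-Lagrange expressions, forces) are tensorial, so nothing
depends on the chart. -/

/-- Coordinates of the point `p` in the preferred chart at `p`. -/
def pt (p : M) : EuclideanSpace ℝ (Fin n) := extChartAt (𝓡 n) p p

/-- The vector with components `v` in the chart `φ` at `c`, tangent at the point with
coordinates `x`; that is `∑ v^i ∂/∂x^i`. -/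
def coordVec (c : M) (x v : EuclideanSpace ℝ (Fin n)) :
    TangentSpace (𝓡 n) ((extChartAt (𝓡 n) c).symm x) :=
  mfderiv 𝓘(ℝ, EuclideanSpace ℝ (Fin n)) (𝓡 n) (extChartAt (𝓡 n) c).symm x v

/-- The extended scalar field `X` as a function `X(x¹, …, xⁿ, v¹, …, vⁿ)` in the natural
coordinates on `TM` induced by the chart at `c`. -/
def inCoords (X : TangentBundle (𝓡 n) M → ℝ) (c : M)
    (z : EuclideanSpace ℝ (Fin n) × EuclideanSpace ℝ (Fin n)) : ℝ :=
  X ⟨(extChartAt (𝓡 n) c).symm z.1, coordVec c z.1 z.2⟩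

/-- The partial derivative `∂/∂x^k` of a function of `(x, v)`. -/
def dx (k : Fin n) (u : EuclideanSpace ℝ (Fin n) × EuclideanSpace ℝ (Fin n) → ℝ)
    (z : EuclideanSpace ℝ (Fin n) × EuclideanSpace ℝ (Fin n)) : ℝ :=
  fderiv ℝ u z (e k, 0)

/-- The partial derivative `∂/∂v^k` of a function of `(x, v)`. -/
def dv (k : Fin n) (u : EuclideanSpace ℝ (Fin n) × EuclideanSpace ℝ (Fin n) → ℝ)
    (z : EuclideanSpace ℝ (Fin n) × EuclideanSpace ℝ (Fin n)) : ℝ :=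
  fderiv ℝ u z (0, e k)

/-- Natural coordinates of `(p, v)`, in the preferred chart at `p`. -/
def zpt (p : M) (v : TangentSpace (𝓡 n) p) :
    EuclideanSpace ℝ (Fin n) × EuclideanSpace ℝ (Fin n) :=
  (pt p, v)

/-! ### The metric -/

/-- The matrix `g_{ij}(x)` of the metric in the chart at `c`. -/
def gram (g : Metric n M) (c : M) (x : EuclideanSpace ℝ (Fin n)) : Matrix (Fin n) (Fin n) ℝ :=
  Matrix.of fun i j =>
    g.inner ((extChartAt (𝓡 n) c).symm x) (coordVec c x (e i)) (coordVec c x (e j))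

/-- The matrix `g_{ij}` at `p`, in the preferred chart at `p`. -/
def gramAt (g : Metric n M) (p : M) : Matrix (Fin n) (Fin n) ℝ := gram g p (pt p)

/-- Christoffel symbols `Γ^k_{ij}` of the Levi-Civita connection at `p`. -/
def christoffel (g : Metric n M) (p : M) (k i j : Fin n) : ℝ :=
  (1 / 2) * ∑ l, (gramAt g p)⁻¹ k l *
    (fderiv ℝ (fun x => gram g p x j l) (pt p) (e i)
      + fderiv ℝ (fun x => gram g p x i l) (pt p) (e j)
      - fderiv ℝ (fun x => gram g p x i j) (pt p) (e l))

/-- The length `|v|`. -/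
def len (g : Metric n M) {p : M} (v : TangentSpace (𝓡 n) p) : ℝ := √(g.inner p v v)

/-- The covariant component `v_r = ∑ g_{rc} v^c`. -/
def lower (g : Metric n M) {p : M} (v : TangentSpace (𝓡 n) p) (r : Fin n) : ℝ :=
  ∑ c, gramAt g p r c * comp v c

/-- The tangent vector with covariant components `a_r`, i.e. with contravariant components
`∑ g^{kr} a_r`. -/
def raise (g : Metric n M) (p : M) (a : Fin n → ℝ) : TangentSpace (𝓡 n) p :=
  ofComp p fun k => ∑ r, (gramAt g p)⁻¹ k r * a r

/-! ### Extended scalar fields -/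

/-- The tangent bundle without its zero section. -/
def slit (n : ℕ) (M : Type*) [TopologicalSpace M]
    [ChartedSpace (EuclideanSpace ℝ (Fin n)) M] [IsManifold (𝓡 n) ∞ M] :
    Set (TangentBundle (𝓡 n) M) :=
  {q | q.2 ≠ 0}

/-- `X` is a smooth function of `(p, v)`, `v ≠ 0`. -/
def SmoothOnSlit (X : TangentBundle (𝓡 n) M → ℝ) : Prop :=
  ContMDiffOn (𝓡 n).tangent 𝓘(ℝ) ∞ X (slit n M)

/-- `X` depends only on the point and on the modulus of velocity (where `v ≠ 0`). -/
def FiberwiseSpherical (g : Metric n M) (X : TangentBundle (𝓡 n) M → ℝ) : Prop :=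
  ∃ w : M → ℝ → ℝ, ∀ (p : M) (v : TangentSpace (𝓡 n) p), v ≠ 0 → X ⟨p, v⟩ = w p (len g v)

/-- `X'`: for a fiberwise spherically symmetric `X(p, v) = w(p, |v|)` this is the derivative of
`w` in its last argument, taken at `|v|`. -/
def radialDeriv (g : Metric n M) (X : TangentBundle (𝓡 n) M → ℝ) (p : M)
    (v : TangentSpace (𝓡 n) p) : ℝ :=
  deriv (fun r : ℝ => X ⟨p, (r / len g v) • v⟩) (len g v)

/-- The component `∇_q X` of the spatial gradient of an extended scalar field:
`∂X/∂x^q - ∑ v^a Γ^b_{qa} ∂X/∂v^b`. -/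
def spatialGrad (g : Metric n M) (X : TangentBundle (𝓡 n) M → ℝ) (p : M)
    (v : TangentSpace (𝓡 n) p) (q : Fin n) : ℝ :=
  dx q (inCoords X p) (zpt p v)
    - ∑ a, ∑ b, comp v a * christoffel g p b q a * dv b (inCoords X p) (zpt p v)

/-- The component `∇_q f = ∂f/∂x^q` of the gradient of a function on `M`. -/
def grad (f : M → ℝ) (p : M) (q : Fin n) : ℝ :=
  fderiv ℝ (fun x : EuclideanSpace ℝ (Fin n) => f ((extChartAt (𝓡 n) p).symm x)) (pt p) (e q)

/-! ### Newtonian and Lagrangian systems -/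

/-- A force field: an extended vector field. -/
abbrev ForceField (n : ℕ) (M : Type*) [TopologicalSpace M]
    [ChartedSpace (EuclideanSpace ℝ (Fin n)) M] [IsManifold (𝓡 n) ∞ M] :=
  ∀ p : M, TangentSpace (𝓡 n) p → TangentSpace (𝓡 n) p

/-- The components `Φ^k = F^k - ∑ Γ^k_{ij} v^i v^j` of the vertical part of the Newtonian vector
field `∑ v^k ∂/∂x^k + ∑ Φ^k ∂/∂v^k` on `TM` with force field `F`. -/
def newtonField (g : Metric n M) (F : ForceField n M) (p : M) (v : TangentSpace (𝓡 n) p)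
    (k : Fin n) : ℝ :=
  comp (F p v) k - ∑ i, ∑ j, christoffel g p k i j * comp v i * comp v j

/-- The curve `γ`, on the set `s` of times, is a trajectory of the Newtonian system with force
field `F`: `∇_t γ' = F(γ, γ')`, where
`(∇_t γ')^k = γ''^k + ∑ Γ^k_{ij} γ'^i γ'^j`. -/
def IsTrajectory (g : Metric n M) (F : ForceField n M) (γ : ℝ → M) (s : Set ℝ) : Prop :=
  ContMDiffOn 𝓘(ℝ) (𝓡 n) 2 γ s ∧
  ∀ t ∈ s, ∀ k : Fin n,
    let u : ℝ → EuclideanSpace ℝ (Fin n) := fun τ => extChartAt (𝓡 n) (γ t) (γ τ)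
    deriv (deriv u) t k
        + ∑ i, ∑ j, christoffel g (γ t) k i j * deriv u t i * deriv u t j
      = comp (F (γ t) (deriv u t)) k

/-- A geodesic (affinely parametrised): a curve with `∇_t γ' = 0`. -/
def IsGeodesic (g : Metric n M) (γ : ℝ → M) (s : Set ℝ) : Prop :=
  IsTrajectory g (fun _ _ => 0) γ s

/-- The matrix `A_{ij} = ∂²L/∂v^i∂v^j` at `(p, v)`. -/
def velHessian (L : TangentBundle (𝓡 n) M → ℝ) (p : M) (v : TangentSpace (𝓡 n) p) :
    Matrix (Fin n) (Fin n) ℝ :=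
  Matrix.of fun i j => dv i (dv j (inCoords L p)) (zpt p v)

/-- The left-hand side of the `k`-th Euler-Lagrange equation `d/dt (∂L/∂v^k) - ∂L/∂x^k = 0`, with
the time derivative expanded along the Newtonian vector field of `F` (`dx^s/dt = v^s`, `dv^s/dt = Φ^s`):
`∑ ∂²L/∂v^k∂v^s Φ^s + ∑ ∂²L/∂v^k∂x^s v^s - ∂L/∂x^k`. -/
def eulerLagrange (g : Metric n M) (L : TangentBundle (𝓡 n) M → ℝ) (F : ForceField n M)
    (p : M) (v : TangentSpace (𝓡 n) p) (k : Fin n) : ℝ :=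
  ∑ s, dv s (dv k (inCoords L p)) (zpt p v) * newtonField g F p v s
    + ∑ s, dx s (dv k (inCoords L p)) (zpt p v) * comp v s
    - dx k (inCoords L p) (zpt p v)

/-- `L` is a regular Lagrange function (smooth with `det A ≠ 0`, for `v ≠ 0`) whose
Euler-Lagrange equations are the Newtonian system with force field `F`. -/
structure IsLagrangeFunction (g : Metric n M) (F : ForceField n M)
    (L : TangentBundle (𝓡 n) M → ℝ) : Prop where
  smooth : SmoothOnSlit L
  regular : ∀ (p : M) (v : TangentSpace (𝓡 n) p), v ≠ 0 → (velHessian L p v).det ≠ 0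
  euler_lagrange : ∀ (p : M) (v : TangentSpace (𝓡 n) p), v ≠ 0 →
    ∀ k, eulerLagrange g L F p v k = 0

/-! ### The two kinds of force fields -/

/-- The force field with covariant components
`F_r = -|v| ∑_s (∇_s W / W') (2 v^s v_r / |v|² - δ^s_r)`. -/
def shiftForce (g : Metric n M) (W : TangentBundle (𝓡 n) M → ℝ) : ForceField n M :=
  fun p v => raise g p fun r =>
    -len g v * ∑ s, spatialGrad g W p v s / radialDeriv g W p v *
      (2 * comp v s * lower g v r / len g v ^ 2 - if s = r then 1 else 0)

/-- The force field with covariant components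
`F_r = -|v|² ∇_r f + 2 (∑_s ∇_s f v^s) v_r`. -/
def conformalForce (g : Metric n M) (f : M → ℝ) : ForceField n M :=
  fun p v => raise g p fun r =>
    -len g v ^ 2 * grad f p r + 2 * (∑ s, grad f p s * comp v s) * lower g v r

/-- The extended scalar field `W = |v| e^{-f}`. -/
def expField (g : Metric n M) (f : M → ℝ) : TangentBundle (𝓡 n) M → ℝ :=
  fun q => len g q.2 * Real.exp (-f q.1)

/-- The conformally equivalent metric `e^{-2f} g`. -/
def conformalMetric (g : Metric n M) (f : M → ℝ) (hf : ContMDiff (𝓡 n) 𝓘(ℝ) ∞ f) :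
    Metric n M where
  inner p := Real.exp (-2 * f p) • g.inner p
  symm p v w := by
    simp [g.symm p v w]
  pos p v hv := by
    have := g.pos p v hv
    have h2 := Real.exp_pos (-2 * f p)
    simpa using mul_pos h2 this
  isVonNBounded p := by
    have h2 := Real.exp_pos (f p)
    refine ((g.isVonNBounded p).image
      (Real.exp (f p) • ContinuousLinearMap.id ℝ (TangentSpace (𝓡 n) p))).subset ?_
    intro v hv
    refine ⟨(Real.exp (f p))⁻¹ • v, ?_, by simp [smul_smul, h2.ne']⟩
    have h3 : Real.exp (-2 * f p) * g.inner p v v < 1 := hv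
    have h4 : Real.exp (-2 * f p) = (Real.exp (f p))⁻¹ * (Real.exp (f p))⁻¹ := by
      rw [← Real.exp_neg, ← Real.exp_add]; ring_nf
    rw [h4, mul_assoc] at h3
    simpa using h3
  contMDiff := by
    have h : ContMDiff (𝓡 n) 𝓘(ℝ) ∞ fun p => Real.exp (-2 * f p) :=
      Real.contDiff_exp.contMDiff.comp (contMDiff_const.mul hf)
    exact h.smul_section g.contMDiff

end

end NewtonLagrange

/-!
In natural coordinates a fiberwise spherically symmetric function is
`X = w(x, √(g_{ij}(x) v^i v^j))` for a function `w(x, r)`, its profile.  Since `|v|` is parallel, the spatial gradient `∇_s X` is the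
plain partial derivative of the profile at constant `r`, and `X'` is its derivative in `r`
(`IsProfile.spatialGrad_eq`, `IsProfile.radialDeriv_eq`).  Likewise all Christoffel symbols drop out
of the Euler-Lagrange expression of a spherically symmetric `L`, which becomes an expression in the
profile `P` of `L`, the force and the direction of `v` (`IsProfile.eulerLagrange_eq`).

**Necessity.** Put `b_k(x, r) = ∇_k W / W'` and let `L` be a Lagrange function with profile `P`.
The Euler-Lagrange equations have the form `P_{x^k} - P_r b_k = c(x, v) v_k`.  As `n ≥ 2`, there is
a `v` of any prescribed length orthogonal to `e_k`, so both sides vanish: `P_{x^k} = P_r b_k`, and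
`c = 0` amounts to `P_{r x^k} = (P_{rr} + P_r / r) b_k`.  Regularity of `L` gives `P_r ≠ 0`.
Differentiating the first relation in `r` and comparing yields `∂_r b_k = b_k / r`, that is
`b_k = r a_k(x)` (`quotient_linear`).

It remains to find a global potential of the covector field `a` (`exists_potential`).  The profile
`w` of `W` satisfies `w_{x^k} = r a_k w_r`, so along a segment in a chart `w` is constant on the
curves with `log r + ∫ a` constant.  Transport along these curves shows that the range of `w(p, ·)`
is locally constant in `p`.  Choose for each possible range a value in it, and let `f(p)` be the
logarithm of the radius, unique because `w_r ≠ 0`, at which `w(p, ·)` takes that value.  Then `f`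
differs from `-∫ a` by a constant in every convex part of a chart, hence `∇f = -a`, and substitution
into the force gives the conformal force field.

**Sufficiency.** The kinetic energy `e^{-2f} |v|² / 2` of the metric `e^{-2f} g` is a Lagrange
function for the conformal force field (`isLagrangeFunction_energy`).

**The conformal metric.** For `W = |v| e^{-f}` one has `∇W / W' = -|v| ∇f`, which makes its force
field the conformal one (`shiftForce_expField`).  The components of the Newtonian vector field,
lowered with the metric, are the force minus the Christoffel symbols of the first kind
(`formAt_newtonField`); for `e^{-2f} g` the derivatives of the conformal factor in those symbols
produce exactly the conformal force (`newtonField_conformalForce`).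
-/

namespace NewtonLagrange

noncomputable section

open Bundle Set Filter Topology

variable {n : ℕ} {M : Type*} [TopologicalSpace M]
  [ChartedSpace (EuclideanSpace ℝ (Fin n)) M] [IsManifold (𝓡 n) ∞ M]

local notation "𝔼" => EuclideanSpace ℝ (Fin n)

/-! ### Natural coordinates on the tangent bundle -/

/-- A tangent vector at `p`, as the vector of `ℝⁿ` of its components in the preferred chart
at `p`. -/
def vec {p : M} (v : TangentSpace (𝓡 n) p) : 𝔼 := v

/-- The vector tangent at `p` whose vector of components in the preferred chart at `p` is `u`. -/
def ofVec (p : M) (u : 𝔼) : TangentSpace (𝓡 n) p := u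

omit [IsManifold (𝓡 n) ∞ M] in
lemma mem_chart_source_symm (c : M) {x : 𝔼} (hx : x ∈ (extChartAt (𝓡 n) c).target) :
    (extChartAt (𝓡 n) c).symm x ∈ (chartAt 𝔼 c).source := by
  have := (extChartAt (𝓡 n) c).map_target hx
  rwa [extChartAt_source] at this

omit [IsManifold (𝓡 n) ∞ M] in
lemma coordVec_eq_mfderivWithin (c : M) (x v : 𝔼) :
    coordVec c x v =
      mfderivWithin 𝓘(ℝ, 𝔼) (𝓡 n) (extChartAt (𝓡 n) c).symm (range (𝓡 n)) x v := by
  rw [ModelWithCorners.range_eq_univ, mfderivWithin_univ]; rfl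

lemma coordVec_eq_symmL (c : M) {x : 𝔼} (hx : x ∈ (extChartAt (𝓡 n) c).target) (v : 𝔼) :
    coordVec c x v = (trivializationAt 𝔼 (TangentSpace (𝓡 n)) c).symmL ℝ
      ((extChartAt (𝓡 n) c).symm x) v := by
  rw [TangentBundle.symmL_trivializationAt (mem_chart_source_symm c hx)]
  have key : ∀ y, y = x → (mfderivWithin 𝓘(ℝ, 𝔼) (𝓡 n) (extChartAt (𝓡 n) c).symm
      (range (𝓡 n)) y v : 𝔼) = coordVec c x v := by
    rintro y rfl; rw [coordVec_eq_mfderivWithin]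
  exact (key _ ((extChartAt (𝓡 n) c).right_inv hx)).symm

omit [IsManifold (𝓡 n) ∞ M] in
lemma coordVec_add (c : M) (x v w : 𝔼) :
    coordVec c x (v + w) = coordVec c x v + coordVec c x w :=
  (mfderiv 𝓘(ℝ, 𝔼) (𝓡 n) (extChartAt (𝓡 n) c).symm x).map_add v w

omit [IsManifold (𝓡 n) ∞ M] in
lemma coordVec_smul (c : M) (x : 𝔼) (a : ℝ) (v : 𝔼) :
    coordVec c x (a • v) = a • coordVec c x v :=
  (mfderiv 𝓘(ℝ, 𝔼) (𝓡 n) (extChartAt (𝓡 n) c).symm x).map_smul a v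

omit [IsManifold (𝓡 n) ∞ M] in
lemma coordVec_sum (c : M) (x : 𝔼) (v : Fin n → 𝔼) :
    coordVec c x (∑ i, v i) = ∑ i, coordVec c x (v i) :=
  map_sum (mfderiv 𝓘(ℝ, 𝔼) (𝓡 n) (extChartAt (𝓡 n) c).symm x) v Finset.univ

lemma coordVec_ne_zero (c : M) {x v : 𝔼} (hx : x ∈ (extChartAt (𝓡 n) c).target) (hv : v ≠ 0) :
    coordVec c x v ≠ 0 := by
  intro h
  rw [coordVec_eq_symmL c hx] at h
  have hb : (extChartAt (𝓡 n) c).symm x ∈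
      (trivializationAt 𝔼 (TangentSpace (𝓡 n)) c).baseSet := mem_chart_source_symm c hx
  have := (trivializationAt 𝔼 (TangentSpace (𝓡 n)) c).continuousLinearMapAt_symmL (R := ℝ) hb v
  rw [h, map_zero] at this
  exact hv this.symm

lemma vec_coordVec_pt (p : M) (v : 𝔼) : vec (coordVec p (pt p) v) = v := by
  have h := mfderivWithin_range_extChartAt_symm (I := 𝓡 n) (x := p)
  rw [coordVec_eq_mfderivWithin]
  exact congrArg (fun T : 𝔼 →L[ℝ] 𝔼 => T v) h

/-- The point of the tangent bundle with natural coordinates `z = (x, v)` in the chart at `c`. -/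
def coordPoint (c : M) (z : 𝔼 × 𝔼) : TangentBundle (𝓡 n) M :=
  ⟨(extChartAt (𝓡 n) c).symm z.1, coordVec c z.1 z.2⟩

lemma contMDiffOn_coordPoint (c : M) :
    ContMDiffOn 𝓘(ℝ, 𝔼 × 𝔼) (𝓡 n).tangent ∞ (coordPoint c : 𝔼 × 𝔼 → TangentBundle (𝓡 n) M)
      {z | z.1 ∈ (extChartAt (𝓡 n) c).target} := by
  set e := trivializationAt 𝔼 (TangentSpace (𝓡 n) : M → Type) c
  have hb : ∀ z ∈ {z : 𝔼 × 𝔼 | z.1 ∈ (extChartAt (𝓡 n) c).target},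
      (extChartAt (𝓡 n) c).symm z.1 ∈ e.baseSet := fun z hz => mem_chart_source_symm c hz
  refine (e.contMDiffOn_iff fun z hz => ?_).2 ⟨?_, ?_⟩
  · rw [e.mem_source]; exact hb z hz
  · exact (contMDiffOn_extChartAt_symm c).comp contDiff_fst.contMDiff.contMDiffOn fun z hz => hz
  · refine contDiff_snd.contMDiff.contMDiffOn.congr fun z hz => ?_
    simp only [coordPoint]
    rw [coordVec_eq_symmL c hz, e.symmL_apply (hb z hz), e.apply_mk_symm (hb z hz)]

omit [IsManifold (𝓡 n) ∞ M] in
lemma isOpen_coord_target (c : M) :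
    IsOpen {z : 𝔼 × 𝔼 | z.1 ∈ (extChartAt (𝓡 n) c).target} :=
  (isOpen_extChartAt_target c).preimage continuous_fst

/-- In natural coordinates, a function that is smooth off the zero section is smooth where
`v ≠ 0`. -/
lemma SmoothOnSlit.contDiffAt_inCoords {X : TangentBundle (𝓡 n) M → ℝ} (hX : SmoothOnSlit X)
    (c : M) {z : 𝔼 × 𝔼} (hz : z.1 ∈ (extChartAt (𝓡 n) c).target) (hv : z.2 ≠ 0) :
    ContDiffAt ℝ ∞ (inCoords X c) z := by
  have h1 : ContMDiffOn 𝓘(ℝ, 𝔼 × 𝔼) 𝓘(ℝ) ∞ (inCoords X c)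
      ({z | z.1 ∈ (extChartAt (𝓡 n) c).target} ∩ {z | z.2 ≠ 0}) :=
    hX.comp ((contMDiffOn_coordPoint c).mono inter_subset_left)
      fun w hw => coordVec_ne_zero c hw.1 hw.2
  have ho : IsOpen ({z : 𝔼 × 𝔼 | z.1 ∈ (extChartAt (𝓡 n) c).target} ∩ {z | z.2 ≠ 0}) :=
    (isOpen_coord_target c).inter (isOpen_ne.preimage continuous_snd)
  exact (h1.contDiffOn z ⟨hz, hv⟩).contDiffAt (ho.mem_nhds ⟨hz, hv⟩)

omit [IsManifold (𝓡 n) ∞ M] in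
lemma pt_mem_target (p : M) : pt p ∈ (extChartAt (𝓡 n) p).target := mem_extChartAt_target p

/-! ### The metric in natural coordinates -/

/-- The kinetic form `(p, v) ↦ g(v, v)` is smooth on the whole tangent bundle. -/
lemma contMDiff_normSq (g : Metric n M) :
    ContMDiff (𝓡 n).tangent 𝓘(ℝ) ∞ fun q : TangentBundle (𝓡 n) M => g.inner q.1 q.2 q.2 := by
  intro q
  have hid : ContMDiffAt (𝓡 n).tangent (𝓡 n).tangent ∞
      (fun q : TangentBundle (𝓡 n) M => (⟨q.1, q.2⟩ : TangentBundle (𝓡 n) M)) q := contMDiffAt_id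
  have hb : ContMDiffAt (𝓡 n).tangent (𝓡 n) ∞ (fun q : TangentBundle (𝓡 n) M => q.1) q :=
    (contMDiff_proj (TangentSpace (𝓡 n))).contMDiffAt
  have : ContMDiffAt (𝓡 n).tangent ((𝓡 n).prod 𝓘(ℝ)) ∞
      (fun q : TangentBundle (𝓡 n) M =>
        TotalSpace.mk' ℝ (E := Bundle.Trivial M ℝ) q.1 (g.inner q.1 q.2 q.2)) q := by
    apply ContMDiffAt.clm_bundle_apply₂ (F₁ := 𝔼) (F₂ := 𝔼)
    · exact ContMDiffAt.comp q (g.contMDiff.contMDiffAt) hb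
    · exact hid
    · exact hid
  rw [contMDiffAt_totalSpace] at this
  exact this.2

lemma contDiffOn_gram (g : Metric n M) (c : M) (i j : Fin n) :
    ContDiffOn ℝ ∞ (fun x => gram g c x i j) (extChartAt (𝓡 n) c).target := by
  have hQ : ∀ w : 𝔼, ContDiffOn ℝ ∞
      (fun x => g.inner _ (coordVec c x w) (coordVec c x w)) (extChartAt (𝓡 n) c).target := by
    intro w
    have h1 : ContMDiffOn 𝓘(ℝ, 𝔼) 𝓘(ℝ) ∞
        (fun x => g.inner _ (coordVec c x w) (coordVec c x w)) (extChartAt (𝓡 n) c).target :=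
      ((contMDiff_normSq g).comp_contMDiffOn (contMDiffOn_coordPoint c)).comp
        (t := {z | z.1 ∈ (extChartAt (𝓡 n) c).target}) (f := fun x : 𝔼 => (x, w))
        (contDiff_prodMk_left w).contMDiff.contMDiffOn fun x hx => hx
    exact h1.contDiffOn
  -- polarisation
  have := (((hQ (e i + e j)).sub (hQ (e i))).sub (hQ (e j))).mul
    (contDiffOn_const (c := (1 / 2 : ℝ)))
  refine this.congr fun x hx => ?_
  simp only [gram, Matrix.of_apply, coordVec_add, map_add, add_apply]
  rw [g.symm _ (coordVec c x (e j))]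
  ring

/-! ### Spherically symmetric functions of position and velocity -/

section Calculus

variable {E ι : Type*} [NormedAddCommGroup E] [NormedSpace ℝ E] [Fintype ι]

/-- The bilinear form `∑ G_{ij}(x) ℓ_i ⊗ ℓ_j`, depending on the point `x`. -/
def bilin (G : ι → ι → E → ℝ) (l : ι → E →L[ℝ] ℝ) (x v w : E) : ℝ :=
  ∑ i, ∑ j, G i j x * (l i v * l j w)

/-- The derivative in the direction `u` of the coefficients of `bilin G l` at `x`. -/
def bilinDeriv (G : ι → ι → E → ℝ) (l : ι → E →L[ℝ] ℝ) (x u v w : E) : ℝ :=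
  ∑ i, ∑ j, fderiv ℝ (G i j) x u * (l i v * l j w)

variable {G : ι → ι → E → ℝ} {l : ι → E →L[ℝ] ℝ}

lemma bilin_symm (hs : ∀ i j x, G i j x = G j i x) (x v w : E) :
    bilin G l x v w = bilin G l x w v := by
  rw [bilin, Finset.sum_comm]
  refine Finset.sum_congr rfl fun i _ => Finset.sum_congr rfl fun j _ => ?_
  rw [hs j i, mul_comm (l j v)]

lemma bilin_smul_smul (x v : E) (a : ℝ) :
    bilin G l x (a • v) (a • v) = a ^ 2 * bilin G l x v v := by
  simp only [bilin, map_smul, Finset.mul_sum, smul_eq_mul]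
  refine Finset.sum_congr rfl fun i _ => Finset.sum_congr rfl fun j _ => ?_
  ring

/-- The derivative of `(x, v) ↦ B_x(v, b(x, v))`. -/
lemma exists_hasFDerivAt_bilin {z : E × E} (hG : ∀ i j, DifferentiableAt ℝ (G i j) z.1)
    {b : E × E → E} {b' : E × E →L[ℝ] E} (hb : HasFDerivAt b b' z) :
    ∃ T : E × E →L[ℝ] ℝ, HasFDerivAt (fun z : E × E => bilin G l z.1 z.2 (b z)) T z ∧
      ∀ ξ η, T (ξ, η) = bilinDeriv G l z.1 ξ z.2 (b z) + bilin G l z.1 η (b z)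
        + bilin G l z.1 z.2 (b' (ξ, η)) := by
  have h1 : ∀ i j, HasFDerivAt (fun z : E × E => G i j z.1)
      (fderiv ℝ (G i j) z.1 ∘L ContinuousLinearMap.fst ℝ E E) z := fun i j =>
    (hG i j).hasFDerivAt.comp z hasFDerivAt_fst
  have h2 : ∀ i, HasFDerivAt (fun z : E × E => l i z.2)
      (l i ∘L ContinuousLinearMap.snd ℝ E E) z := fun i =>
    (l i).hasFDerivAt.comp z hasFDerivAt_snd
  have h3 : ∀ j, HasFDerivAt (fun z : E × E => l j (b z)) (l j ∘L b') z := fun j =>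
    (l j).hasFDerivAt.comp z hb
  refine ⟨_, HasFDerivAt.fun_sum fun i _ => HasFDerivAt.fun_sum fun j _ =>
    (h1 i j).mul ((h2 i).mul (h3 j)), fun ξ η => ?_⟩
  simp only [bilin, bilinDeriv, ← Finset.sum_add_distrib, FunLike.coe_sum, Finset.sum_apply]
  refine Finset.sum_congr rfl fun i _ => Finset.sum_congr rfl fun j _ => ?_
  simp only [smul_apply, add_apply, smul_eq_mul, ContinuousLinearMap.comp_apply,
    ContinuousLinearMap.coe_fst', ContinuousLinearMap.coe_snd']
  ring

/-- The derivative of `(x, v) ↦ √(B_x(v, v))`. -/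
lemma exists_hasFDerivAt_sqrt_bilin {z : E × E} (hG : ∀ i j, DifferentiableAt ℝ (G i j) z.1)
    (hs : ∀ i j x, G i j x = G j i x) (hpos : 0 < bilin G l z.1 z.2 z.2) :
    ∃ T : E × E →L[ℝ] ℝ, HasFDerivAt (fun z : E × E => √(bilin G l z.1 z.2 z.2)) T z ∧
      ∀ ξ η, T (ξ, η) = (bilinDeriv G l z.1 ξ z.2 z.2 / 2 + bilin G l z.1 z.2 η) /
        √(bilin G l z.1 z.2 z.2) := by
  obtain ⟨T, hT, hT'⟩ := exists_hasFDerivAt_bilin (l := l) hG (hasFDerivAt_snd (p := z))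
  refine ⟨_, hT.sqrt hpos.ne', fun ξ η => ?_⟩
  have hr : √(bilin G l z.1 z.2 z.2) ≠ 0 := (Real.sqrt_pos.2 hpos).ne'
  rw [smul_apply, hT', smul_eq_mul, ContinuousLinearMap.coe_snd', bilin_symm hs z.1 η]
  field_simp
  ring

variable {P : E × ℝ → ℝ} {u : E × E → ℝ} {x v : E}

/-- The first derivative of `u(x, v) = P(x, √(B_x(v, v)))`. -/
lemma fderiv_spherical (hG : ∀ i j, DifferentiableAt ℝ (G i j) x)
    (hs : ∀ i j x, G i j x = G j i x) (hpos : 0 < bilin G l x v v)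
    (hP : DifferentiableAt ℝ P (x, √(bilin G l x v v)))
    (hu : u =ᶠ[𝓝 (x, v)] fun z => P (z.1, √(bilin G l z.1 z.2 z.2))) (ξ η : E) :
    fderiv ℝ u (x, v) (ξ, η) = fderiv ℝ P (x, √(bilin G l x v v)) (ξ, 0) +
      fderiv ℝ P (x, √(bilin G l x v v)) (0, 1) *
        ((bilinDeriv G l x ξ v v / 2 + bilin G l x v η) / √(bilin G l x v v)) := by
  obtain ⟨T, hT, hT'⟩ := exists_hasFDerivAt_sqrt_bilin (l := l) (z := (x, v)) hG hs hpos
  have h1 : HasFDerivAt (fun z : E × E => (z.1, √(bilin G l z.1 z.2 z.2))) _ (x, v) :=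
    hasFDerivAt_fst.prodMk hT
  have h2 := HasFDerivAt.comp (x, v) (f := fun z : E × E => (z.1, √(bilin G l z.1 z.2 z.2)))
    hP.hasFDerivAt h1
  rw [hu.fderiv_eq]
  have h3 : fderiv ℝ (fun z : E × E => P (z.1, √(bilin G l z.1 z.2 z.2))) (x, v) = _ := h2.fderiv
  have h4 : ∀ a : ℝ, ((ξ, a) : E × ℝ) = (ξ, 0) + a • ((0, 1) : E × ℝ) := fun a => by
    ext <;> simp
  rw [h3, ContinuousLinearMap.comp_apply, ContinuousLinearMap.prod_apply,
    ContinuousLinearMap.coe_fst', hT', h4, map_add, map_smul, smul_eq_mul, mul_comm]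

/-- The derivative of the velocity gradient of `u(x, v) = P(x, √(B_x(v, v)))`. -/
lemma fderiv_fderiv_spherical (hG : ∀ i j, ContDiffAt ℝ ∞ (G i j) x)
    (hs : ∀ i j x, G i j x = G j i x) (hpos : 0 < bilin G l x v v)
    (hP : ContDiffAt ℝ ∞ P (x, √(bilin G l x v v)))
    (hu : u =ᶠ[𝓝 (x, v)] fun z => P (z.1, √(bilin G l z.1 z.2 z.2))) (ξ η e : E) :
    fderiv ℝ (fun z => fderiv ℝ u z (0, e)) (x, v) (ξ, η) =
      (fderiv ℝ (fun y => fderiv ℝ P y (0, 1)) (x, √(bilin G l x v v)) (ξ, 0) +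
        fderiv ℝ (fun y => fderiv ℝ P y (0, 1)) (x, √(bilin G l x v v)) (0, 1) *
          ((bilinDeriv G l x ξ v v / 2 + bilin G l x v η) / √(bilin G l x v v))) *
            (bilin G l x v e / √(bilin G l x v v)) +
      fderiv ℝ P (x, √(bilin G l x v v)) (0, 1) *
        ((bilinDeriv G l x ξ v e + bilin G l x η e) / √(bilin G l x v v)
        - bilin G l x v e * (bilinDeriv G l x ξ v v / 2 + bilin G l x v η) /
            √(bilin G l x v v) ^ 3) := by
  have hGd : ∀ i j, DifferentiableAt ℝ (G i j) x := fun i j => (hG i j).differentiableAt (by simp)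
  have hr : 0 < √(bilin G l x v v) := Real.sqrt_pos.2 hpos
  obtain ⟨T, hT, hT'⟩ := exists_hasFDerivAt_sqrt_bilin (l := l) (z := (x, v)) hGd hs hpos
  obtain ⟨S, hS, hS'⟩ := exists_hasFDerivAt_bilin (l := l) (z := (x, v)) hGd
    (hasFDerivAt_const e (x, v))
  have hcont : ContinuousAt (fun z : E × E => (z.1, √(bilin G l z.1 z.2 z.2))) (x, v) :=
    continuousAt_fst.prodMk hT.continuousAt
  -- the first derivative is known in a neighbourhood
  have hev : (fun z => fderiv ℝ u z (0, e)) =ᶠ[𝓝 (x, v)] fun z =>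
      (fun y => fderiv ℝ P y (0, 1)) (z.1, √(bilin G l z.1 z.2 z.2)) *
        (bilin G l z.1 z.2 e / √(bilin G l z.1 z.2 z.2)) := by
    have e1 : ∀ᶠ z : E × E in 𝓝 (x, v), ∀ i j, DifferentiableAt ℝ (G i j) z.1 := by
      have h : ∀ᶠ y in 𝓝 x, ∀ i j, DifferentiableAt ℝ (G i j) y := by
        refine eventually_all.2 fun i => eventually_all.2 fun j => ?_
        exact (((hG i j).of_le (m := 1) (by norm_cast)).eventually (by simp)).mono
          fun y hy => hy.differentiableAt (by simp)
      exact (continuousAt_fst (p := (x, v))).eventually h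
    have e2 : ∀ᶠ z : E × E in 𝓝 (x, v),
        DifferentiableAt ℝ P (z.1, √(bilin G l z.1 z.2 z.2)) := by
      have h := ((hP.of_le (m := 1) (by norm_cast)).eventually (by simp)).mono
        fun y hy => hy.differentiableAt (by simp)
      exact hcont.eventually h
    have e3 : ∀ᶠ z : E × E in 𝓝 (x, v), 0 < √(bilin G l z.1 z.2 z.2) :=
      hT.continuousAt.eventually (lt_mem_nhds hr)
    filter_upwards [e1, e2, e3, eventually_eventually_nhds.2 hu] with z h1 h2 h3 h4
    have h5 := fderiv_spherical (u := u) (x := z.1) (v := z.2) h1 hs (Real.sqrt_pos.1 h3) h2 h4 0 e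
    rw [show z = (z.1, z.2) from rfl, h5]
    have h0 : ((0, 0) : E × ℝ) = 0 := rfl
    simp [h0, bilinDeriv]
  rw [hev.fderiv_eq]
  have hP' : DifferentiableAt ℝ (fun y => fderiv ℝ P y (0, 1)) (x, √(bilin G l x v v)) := by
    have : ContDiffAt ℝ 1 (fderiv ℝ P) (x, √(bilin G l x v v)) :=
      hP.fderiv_right (by norm_cast)
    exact (this.clm_apply contDiffAt_const).differentiableAt (by simp)
  set p : E × ℝ → ℝ := fun y => fderiv ℝ P y (0, 1) with hp
  have d1 : HasFDerivAt (fun z : E × E => p (z.1, √(bilin G l z.1 z.2 z.2)))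
      (fderiv ℝ (fun z : E × E => p (z.1, √(bilin G l z.1 z.2 z.2))) (x, v)) (x, v) := by
    refine DifferentiableAt.hasFDerivAt ?_
    exact DifferentiableAt.comp (x, v) (f := fun z : E × E => (z.1, √(bilin G l z.1 z.2 z.2)))
      (g := p) hP' (differentiableAt_fst.prodMk hT.differentiableAt)
  have d2 : HasFDerivAt (fun z : E × E => bilin G l z.1 z.2 e * (√(bilin G l z.1 z.2 z.2))⁻¹) _
    (x, v) := hS.mul ((hasDerivAt_inv hr.ne').comp_hasFDerivAt (x, v) hT)
  have h5 : fderiv ℝ (fun z : E × E => p (z.1, √(bilin G l z.1 z.2 z.2)) *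
      (bilin G l z.1 z.2 e * (√(bilin G l z.1 z.2 z.2))⁻¹)) (x, v) = _ := (d1.mul d2).fderiv
  simp only [div_eq_mul_inv (bilin G l _ _ e)]
  rw [h5]
  have h6 := fderiv_spherical hGd hs hpos hP' (EventuallyEq.refl _ _) ξ η
  have h0 : bilin G l x v (0 : E) = 0 := by simp [bilin]
  simp only [smul_apply, add_apply, smul_eq_mul, h6, hT', hS', zero_apply, h0]
  field_simp
  ring

end Calculus

/-! ### The metric and its Christoffel symbols in coordinates -/

lemma sum_smul_e (v : 𝔼) : ∑ i, v i • (e i : 𝔼) = v := by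
  ext k
  simp [e, Pi.single_apply]

lemma clm_eq_sum (T : 𝔼 →L[ℝ] ℝ) (v : 𝔼) : T v = ∑ i, v i * T (e i) := by
  conv_lhs => rw [← sum_smul_e v]
  simp

/-- The coordinate functionals of `ℝⁿ`. -/
abbrev coordFun (n : ℕ) (i : Fin n) : EuclideanSpace ℝ (Fin n) →L[ℝ] ℝ := EuclideanSpace.proj i

/-- The metric in the chart at `c`, as a bilinear form `∑ g_{ij}(x) dx^i ⊗ dx^j` on `ℝⁿ`
depending on `x`. -/
abbrev form (g : Metric n M) (c : M) : 𝔼 → 𝔼 → 𝔼 → ℝ :=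
  bilin (fun i j x => gram g c x i j) (coordFun n)

lemma form_eq_inner (g : Metric n M) (c : M) (x v w : 𝔼) :
    form g c x v w = g.inner _ (coordVec c x v) (coordVec c x w) := by
  conv_rhs => rw [← sum_smul_e v, ← sum_smul_e w]
  simp only [coordVec_sum, coordVec_smul, map_sum, map_smul, form, bilin,
    FunLike.coe_sum, Finset.sum_apply, smul_apply, smul_eq_mul,
    EuclideanSpace.coe_proj, gram, Matrix.of_apply, Finset.mul_sum]
  rw [Finset.sum_comm]
  refine Finset.sum_congr rfl fun i _ => Finset.sum_congr rfl fun j _ => ?_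
  ring

lemma gram_symm (g : Metric n M) (c : M) (i j : Fin n) (x : 𝔼) :
    gram g c x i j = gram g c x j i := by
  simp only [gram, Matrix.of_apply, g.symm _ (coordVec c x (e i))]

lemma form_symm (g : Metric n M) (c : M) (x v w : 𝔼) : form g c x v w = form g c x w v :=
  bilin_symm (gram_symm g c) x v w

lemma form_pos (g : Metric n M) (c : M) {x v : 𝔼} (hx : x ∈ (extChartAt (𝓡 n) c).target)
    (hv : v ≠ 0) : 0 < form g c x v v := by
  rw [form_eq_inner]; exact g.pos _ _ (coordVec_ne_zero c hx hv)

lemma len_coordVec (g : Metric n M) (c : M) (x v : 𝔼) :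
    len g (coordVec c x v) = √(form g c x v v) := by
  rw [form_eq_inner]; rfl

lemma contDiffAt_gram (g : Metric n M) (c : M) {x : 𝔼}
    (hx : x ∈ (extChartAt (𝓡 n) c).target) (i j : Fin n) :
    ContDiffAt ℝ ∞ (fun x => gram g c x i j) x :=
  (contDiffOn_gram g c i j x hx).contDiffAt ((isOpen_extChartAt_target c).mem_nhds hx)

/-- The metric at `p`, in the preferred chart at `p`, as a bilinear form on `ℝⁿ`. -/
abbrev formAt (g : Metric n M) (p : M) : 𝔼 → 𝔼 → ℝ := form g p (pt p)

/-- The derivative of the metric coefficients at `p`: `formDeriv g p u v w` is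
`∑ ∂_k g_{ij} u^k v^i w^j`. -/
abbrev formDeriv (g : Metric n M) (p : M) : 𝔼 → 𝔼 → 𝔼 → ℝ :=
  bilinDeriv (fun i j x => gram g p x i j) (coordFun n) (pt p)

lemma formAt_vec (g : Metric n M) (p : M) (v w : TangentSpace (𝓡 n) p) :
    formAt g p (vec v) (vec w) = g.inner p v w := by
  have key : ∀ (q : M) (_ : q = p) (a b : 𝔼), a = vec v → b = vec w →
      g.inner q (ofVec q a) (ofVec q b) = g.inner p v w := by
    rintro q rfl a b rfl rfl; rfl
  rw [formAt, form_eq_inner]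
  exact key _ (extChartAt_to_inv p) _ _ (vec_coordVec_pt p (vec v)) (vec_coordVec_pt p (vec w))

lemma len_eq (g : Metric n M) (p : M) (v : TangentSpace (𝓡 n) p) :
    len g v = √(formAt g p (vec v) (vec v)) := by
  rw [formAt_vec]; rfl

omit [IsManifold (𝓡 n) ∞ M] in
lemma vec_ne_zero {p : M} {v : TangentSpace (𝓡 n) p} (hv : v ≠ 0) : vec v ≠ 0 := hv

lemma formAt_pos (g : Metric n M) (p : M) {v : 𝔼} (hv : v ≠ 0) : 0 < formAt g p v v :=
  form_pos g p (pt_mem_target p) hv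

lemma len_sq (g : Metric n M) (p : M) (v : TangentSpace (𝓡 n) p) :
    len g v ^ 2 = formAt g p (vec v) (vec v) := by
  rw [len_eq, Real.sq_sqrt]
  by_cases hv : vec v = 0
  · rw [hv]; simp [bilin]
  · exact (formAt_pos g p hv).le

lemma len_pos (g : Metric n M) (p : M) {v : TangentSpace (𝓡 n) p} (hv : v ≠ 0) : 0 < len g v := by
  rw [len_eq]; exact Real.sqrt_pos.2 (formAt_pos g p (vec_ne_zero hv))

lemma formAt_e (g : Metric n M) (p : M) (v : 𝔼) (r : Fin n) :
    formAt g p v (e r) = ∑ c, gramAt g p r c * v c := by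
  simp only [formAt, form, bilin, EuclideanSpace.coe_proj, e, PiLp.single_apply]
  simp [gramAt, gram_symm g p r, mul_comm]

lemma lower_eq (g : Metric n M) (p : M) (v : TangentSpace (𝓡 n) p) (r : Fin n) :
    lower g v r = formAt g p (vec v) (e r) := by
  rw [formAt_e]; rfl

lemma formAt_eq_sum (g : Metric n M) (p : M) (v u : 𝔼) :
    formAt g p v u = ∑ r, u r * formAt g p v (e r) := by
  simp only [formAt_e, Finset.mul_sum]
  rw [Finset.sum_comm, formAt, form, bilin]
  refine Finset.sum_congr rfl fun c _ => Finset.sum_congr rfl fun r _ => ?_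
  rw [show gramAt g p r c = gram g p (pt p) c r from gram_symm g p r c _]
  simp only [EuclideanSpace.coe_proj]
  ring

lemma isUnit_det_gramAt (g : Metric n M) (p : M) : IsUnit (gramAt g p).det := by
  rw [isUnit_iff_ne_zero]
  intro h
  obtain ⟨a, ha, h0⟩ := Matrix.exists_mulVec_eq_zero_iff.2 h
  have hv0 : (WithLp.toLp 2 a : 𝔼) ≠ 0 := by
    intro hz
    apply ha
    funext k
    exact congrArg (fun u : 𝔼 => u k) hz
  refine (formAt_pos g p hv0).ne' ?_
  rw [formAt_eq_sum]
  refine Finset.sum_eq_zero fun r _ => ?_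
  rw [formAt_e,
    show ∑ c, gramAt g p r c * (WithLp.toLp 2 a : 𝔼) c = (gramAt g p).mulVec a r from rfl, h0]
  simp

lemma gramAt_mulVec_inv_mulVec (g : Metric n M) (p : M) (a : Fin n → ℝ) :
    (gramAt g p).mulVec ((gramAt g p)⁻¹.mulVec a) = a := by
  rw [Matrix.mulVec_mulVec, Matrix.mul_nonsing_inv _ (isUnit_det_gramAt g p), Matrix.one_mulVec]

lemma lower_raise (g : Metric n M) (p : M) (a : Fin n → ℝ) (r : Fin n) :
    lower g (raise g p a) r = a r :=
  congrFun (gramAt_mulVec_inv_mulVec g p a) r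

lemma lower_injective (g : Metric n M) (p : M) :
    Function.Injective (fun v : TangentSpace (𝓡 n) p => lower g v) := by
  intro v w h
  have h1 : ∀ v : TangentSpace (𝓡 n) p, lower g v = (gramAt g p).mulVec (comp v) := by
    intro v; funext k; rfl
  simp only [h1] at h
  have h2 := congrArg (fun a => (gramAt g p)⁻¹.mulVec a) h
  simp only [Matrix.mulVec_mulVec, Matrix.nonsing_inv_mul _ (isUnit_det_gramAt g p),
    Matrix.one_mulVec] at h2
  have h3 : ∀ k, (vec v) k = (vec w) k := congrFun h2
  exact (PiLp.ext h3 : vec v = vec w)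

/-- The Christoffel symbols of the first kind. -/
lemma sum_gramAt_mul_christoffel (g : Metric n M) (p : M) (m i j : Fin n) :
    ∑ k, gramAt g p m k * christoffel g p k i j =
      (1 / 2) * (fderiv ℝ (fun x => gram g p x j m) (pt p) (e i)
        + fderiv ℝ (fun x => gram g p x i m) (pt p) (e j)
        - fderiv ℝ (fun x => gram g p x i j) (pt p) (e m)) := by
  have h := congrFun (gramAt_mulVec_inv_mulVec g p fun l =>
      fderiv ℝ (fun x => gram g p x j l) (pt p) (e i)
        + fderiv ℝ (fun x => gram g p x i l) (pt p) (e j)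
        - fderiv ℝ (fun x => gram g p x i j) (pt p) (e l)) m
  rw [← h]
  simp only [christoffel, Matrix.mulVec, dotProduct, Finset.mul_sum]
  refine Finset.sum_congr rfl fun k _ => Finset.sum_congr rfl fun l _ => ?_
  ring

lemma formDeriv_e_left (g : Metric n M) (p : M) (m : Fin n) (v w : 𝔼) :
    formDeriv g p (e m) v w =
      ∑ i, ∑ j, fderiv ℝ (fun x => gram g p x i j) (pt p) (e m) * (v i * w j) := rfl

lemma formDeriv_e_right' (g : Metric n M) (p : M) (m : Fin n) (u v : 𝔼) :
    formDeriv g p u v (e m) = ∑ j, fderiv ℝ (fun x => gram g p x j m) (pt p) u * v j := by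
  simp only [formDeriv, bilinDeriv, EuclideanSpace.coe_proj, e, PiLp.single_apply]
  simp

lemma formDeriv_eq_sum_right (g : Metric n M) (p : M) (u v w : 𝔼) :
    formDeriv g p u v w = ∑ m, w m * formDeriv g p u v (e m) := by
  simp only [formDeriv_e_right', Finset.mul_sum]
  rw [Finset.sum_comm, formDeriv, bilinDeriv]
  refine Finset.sum_congr rfl fun i _ => Finset.sum_congr rfl fun j _ => ?_
  simp only [EuclideanSpace.coe_proj]
  ring

lemma formDeriv_eq_sum_left (g : Metric n M) (p : M) (u v w : 𝔼) :
    formDeriv g p u v w = ∑ m, u m * formDeriv g p (e m) v w := by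
  simp only [formDeriv, bilinDeriv, Finset.mul_sum]
  conv_rhs => rw [Finset.sum_comm]
  refine Finset.sum_congr rfl fun i _ => ?_
  conv_rhs => rw [Finset.sum_comm]
  refine Finset.sum_congr rfl fun j _ => ?_
  rw [clm_eq_sum, Finset.sum_mul]
  refine Finset.sum_congr rfl fun m _ => ?_
  ring

lemma formDeriv_e_right (g : Metric n M) (p : M) (m : Fin n) (u v : 𝔼) :
    formDeriv g p u v (e m) =
      ∑ i, ∑ j, fderiv ℝ (fun x => gram g p x j m) (pt p) (e i) * (u i * v j) := by
  rw [formDeriv_e_right', Finset.sum_comm]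
  refine Finset.sum_congr rfl fun j _ => ?_
  rw [clm_eq_sum, Finset.sum_mul]
  refine Finset.sum_congr rfl fun i _ => ?_
  ring

/-- The covariant components of the quadratic form `∑ Γ^k_{ij} v^i v^j`. -/
lemma sum_gramAt_mul_christoffel_quadratic (g : Metric n M) (p : M) (v : 𝔼) (m : Fin n) :
    ∑ k, gramAt g p m k * ∑ i, ∑ j, christoffel g p k i j * v i * v j =
      formDeriv g p v v (e m) - formDeriv g p (e m) v v / 2 := by
  have h1 : ∑ k, gramAt g p m k * ∑ i, ∑ j, christoffel g p k i j * v i * v j =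
      ∑ i, ∑ j, (∑ k, gramAt g p m k * christoffel g p k i j) * (v i * v j) := by
    simp only [Finset.mul_sum, Finset.sum_mul]
    rw [Finset.sum_comm]
    refine Finset.sum_congr rfl fun i _ => ?_
    rw [Finset.sum_comm]
    refine Finset.sum_congr rfl fun j _ => Finset.sum_congr rfl fun k _ => ?_
    ring
  have h2 : formDeriv g p v v (e m) =
      ∑ i, ∑ j, fderiv ℝ (fun x => gram g p x i m) (pt p) (e j) * (v i * v j) := by
    rw [formDeriv_e_right, Finset.sum_comm]
    refine Finset.sum_congr rfl fun i _ => Finset.sum_congr rfl fun j _ => ?_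
    ring
  have h3 : formDeriv g p v v (e m) - formDeriv g p (e m) v v / 2 =
      (1 / 2) * (formDeriv g p v v (e m) + formDeriv g p v v (e m) - formDeriv g p (e m) v v) := by
    ring
  rw [h1, h3]
  conv_rhs => rw [formDeriv_e_left]; enter [2, 1, 1]; rw [formDeriv_e_right]
  rw [h2]
  simp only [sum_gramAt_mul_christoffel, ← Finset.sum_add_distrib, ← Finset.sum_sub_distrib,
    Finset.mul_sum]
  refine Finset.sum_congr rfl fun i _ => Finset.sum_congr rfl fun j _ => ?_
  ring

/-- The length is parallel: the Christoffel correction of its gradient is its partial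
derivative in `x`. -/
lemma sum_christoffel_mul_formAt (g : Metric n M) (p : M) (v : 𝔼) (q : Fin n) :
    ∑ a, ∑ b, v a * christoffel g p b q a * formAt g p v (e b) = formDeriv g p (e q) v v / 2 := by
  have h1 : ∑ a, ∑ b, v a * christoffel g p b q a * formAt g p v (e b) =
      ∑ a, ∑ c, (∑ b, gramAt g p c b * christoffel g p b q a) * (v a * v c) := by
    refine Finset.sum_congr rfl fun a _ => ?_
    simp only [formAt_e, Finset.mul_sum, Finset.sum_mul]
    rw [Finset.sum_comm]
    refine Finset.sum_congr rfl fun c _ => Finset.sum_congr rfl fun b _ => ?_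
    rw [show gramAt g p b c = gramAt g p c b from gram_symm g p b c _]
    ring
  have h2 : ∑ a, ∑ c, fderiv ℝ (fun x => gram g p x q c) (pt p) (e a) * (v a * v c) =
      ∑ a, ∑ c, fderiv ℝ (fun x => gram g p x q a) (pt p) (e c) * (v a * v c) := by
    rw [Finset.sum_comm]
    refine Finset.sum_congr rfl fun a _ => Finset.sum_congr rfl fun c _ => ?_
    ring
  have h3 : ∑ a, ∑ c, (∑ b, gramAt g p c b * christoffel g p b q a) * (v a * v c) =
      (1 / 2) * (∑ a, ∑ c, fderiv ℝ (fun x => gram g p x a c) (pt p) (e q) * (v a * v c)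
        + ∑ a, ∑ c, fderiv ℝ (fun x => gram g p x q c) (pt p) (e a) * (v a * v c)
        - ∑ a, ∑ c, fderiv ℝ (fun x => gram g p x q a) (pt p) (e c) * (v a * v c)) := by
    simp only [sum_gramAt_mul_christoffel, ← Finset.sum_add_distrib, ← Finset.sum_sub_distrib,
      Finset.mul_sum]
    refine Finset.sum_congr rfl fun i _ => Finset.sum_congr rfl fun j _ => ?_
    ring
  rw [h1, h3, h2, formDeriv_e_left]
  ring

/-- The covariant components of the vertical part of the Newtonian vector field. -/
lemma formAt_newtonField (g : Metric n M) (F : ForceField n M) (p : M) (v : TangentSpace (𝓡 n) p)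
    (m : Fin n) : formAt g p (WithLp.toLp 2 (newtonField g F p v)) (e m) =
      lower g (F p v) m - formDeriv g p (vec v) (vec v) (e m)
        + formDeriv g p (e m) (vec v) (vec v) / 2 := by
  have h := sum_gramAt_mul_christoffel_quadratic g p (vec v) m
  rw [formAt_e]
  simp only [newtonField, mul_sub, Finset.sum_sub_distrib]
  rw [show ∑ k, gramAt g p m k * ∑ i, ∑ j, christoffel g p k i j * comp v i * comp v j = _ from h,
    lower]
  ring

/-! ### Spherically symmetric scalar fields -/

/-- `w` is a profile of the scalar field `X`: `X(p, v) = w(p, |v|)` for `v ≠ 0`. -/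
def IsProfile (g : Metric n M) (X : TangentBundle (𝓡 n) M → ℝ) (w : M → ℝ → ℝ) : Prop :=
  ∀ (p : M) (v : TangentSpace (𝓡 n) p), v ≠ 0 → X ⟨p, v⟩ = w p (len g v)

/-- The profile `w(x, r)`, with `x` in the chart at `c`. -/
def coordProfile (w : M → ℝ → ℝ) (c : M) (y : 𝔼 × ℝ) : ℝ :=
  w ((extChartAt (𝓡 n) c).symm y.1) y.2

lemma len_smul (g : Metric n M) {p : M} (v : TangentSpace (𝓡 n) p) {a : ℝ} (ha : 0 ≤ a) :
    len g (a • v) = a * len g v := by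
  have : g.inner p (a • v) (a • v) = a ^ 2 * g.inner p v v := by
    simp only [map_smul, smul_apply, smul_eq_mul]; ring
  rw [len, this, Real.sqrt_mul (sq_nonneg a), Real.sqrt_sq ha, len]

section Profile

variable {g : Metric n M} {X : TangentBundle (𝓡 n) M → ℝ} {w : M → ℝ → ℝ}

lemma IsProfile.inCoords_eq (hw : IsProfile g X w) (c : M) {z : 𝔼 × 𝔼}
    (hz : z.1 ∈ (extChartAt (𝓡 n) c).target) (hv : z.2 ≠ 0) :
    inCoords X c z = coordProfile w c (z.1, √(form g c z.1 z.2 z.2)) := by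
  rw [inCoords, hw _ _ (coordVec_ne_zero c hz hv), len_coordVec]
  rfl

lemma IsProfile.inCoords_eventuallyEq (hw : IsProfile g X w) (p : M) {v : 𝔼} (hv : v ≠ 0) :
    inCoords X p =ᶠ[𝓝 (pt (n := n) p, v)]
      fun z => coordProfile w p (z.1, √(form g p z.1 z.2 z.2)) := by
  filter_upwards [(isOpen_coord_target p).mem_nhds (pt_mem_target p : (pt (n := n) p, v).1 ∈ _),
    (isOpen_ne.preimage continuous_snd).mem_nhds (hv : (pt (n := n) p, v).2 ≠ 0)] with z h1 h2
  exact hw.inCoords_eq p h1 h2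

/-- The profile of a smooth field is smooth for `r > 0`: evaluate the field along a vector field of
prescribed length `r`. -/
lemma IsProfile.contDiffAt (hn : 0 < n) (hX : SmoothOnSlit X) (hw : IsProfile g X w) (c : M)
    {x : 𝔼} (hx : x ∈ (extChartAt (𝓡 n) c).target) {r : ℝ} (hr : 0 < r) :
    ContDiffAt ℝ ∞ (coordProfile w c) (x, r) := by
  set a : 𝔼 := e ⟨0, hn⟩ with ha
  have ha0 : a ≠ 0 := by
    intro h
    have := congrArg (fun u : 𝔼 => u ⟨0, hn⟩) h
    simp [ha, e] at this
  have hpos : ∀ y ∈ (extChartAt (𝓡 n) c).target, 0 < √(form g c y a a) := fun y hy =>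
    Real.sqrt_pos.2 (form_pos g c hy ha0)
  have h1 : ContDiffAt ℝ ∞ (fun y : 𝔼 => form g c y a a) x := by
    refine ContDiffAt.sum fun i _ => ContDiffAt.sum fun j _ => ?_
    exact (contDiffAt_gram g c hx i j).mul contDiffAt_const
  have h2 : ContDiffAt ℝ ∞ (fun y : 𝔼 × ℝ => (y.1, (y.2 / √(form g c y.1 a a)) • a)) (x, r) := by
    refine contDiffAt_fst.prodMk (ContDiffAt.fun_smul ?_ contDiffAt_const)
    refine contDiffAt_snd.div ?_ (hpos x hx).ne'
    exact ContDiffAt.sqrt (ContDiffAt.comp (x, r) (f := Prod.fst) h1 contDiffAt_fst)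
      (form_pos g c hx ha0).ne'
  have hne : ∀ y ∈ (extChartAt (𝓡 n) c).target, ∀ s : ℝ, 0 < s →
      (s / √(form g c y a a)) • a ≠ 0 := fun y hy s hs =>
    smul_ne_zero (div_pos hs (hpos y hy)).ne' ha0
  have h3 : ContDiffAt ℝ ∞
      (inCoords X c ∘ fun y : 𝔼 × ℝ => (y.1, (y.2 / √(form g c y.1 a a)) • a)) (x, r) :=
    ContDiffAt.comp (x, r) (hX.contDiffAt_inCoords c hx (hne x hx r hr)) h2
  refine h3.congr_of_eventuallyEq ?_
  filter_upwards [((isOpen_extChartAt_target c).preimage continuous_fst).mem_nhds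
    (hx : (x, r).1 ∈ _), (isOpen_Ioi.preimage continuous_snd).mem_nhds (hr : (x, r).2 ∈ Ioi 0)]
    with y hy hs
  have hy' : 0 < √(form g c y.1 a a) := hpos y.1 hy
  rw [Function.comp_apply, hw.inCoords_eq c (z := (y.1, _)) hy (hne _ hy _ hs)]
  have : √(form g c y.1 ((y.2 / √(form g c y.1 a a)) • a) ((y.2 / √(form g c y.1 a a)) • a))
      = y.2 := by
    rw [form, bilin_smul_smul, Real.sqrt_mul (sq_nonneg _), Real.sqrt_sq (div_pos hs hy').le,
      div_mul_cancel₀ _ hy'.ne']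
  simp only [this]

omit [IsManifold (𝓡 n) ∞ M] in
lemma hasDerivAt_profile {c : M} {x : 𝔼} {r : ℝ}
    (h : DifferentiableAt ℝ (coordProfile w c) (x, r)) :
    HasDerivAt (w ((extChartAt (𝓡 n) c).symm x)) (fderiv ℝ (coordProfile w c) (x, r) (0, 1)) r := by
  have h1 : HasDerivAt (fun s : ℝ => (x, s)) ((0 : 𝔼), (1 : ℝ)) r :=
    (hasDerivAt_const r x).prodMk (hasDerivAt_id r)
  exact h.hasFDerivAt.comp_hasDerivAt r h1

lemma IsProfile.radialDeriv_eq (hw : IsProfile g X w) {p : M}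
    {v : TangentSpace (𝓡 n) p} (hv : v ≠ 0) :
    radialDeriv g X p v = deriv (w p) (len g v) := by
  have hl := len_pos g p hv
  refine EventuallyEq.deriv_eq ?_
  filter_upwards [lt_mem_nhds hl] with s hs
  have h1 : 0 < s / len g v := div_pos hs hl
  rw [hw p _ (smul_ne_zero h1.ne' hv), len_smul g v h1.le, div_mul_cancel₀ _ hl.ne']

/-- The spatial gradient of a spherically symmetric field is the gradient of its profile in the
position at constant `r`. -/
lemma IsProfile.spatialGrad_eq (hw : IsProfile g X w) {p : M}
    {v : TangentSpace (𝓡 n) p} (hv : v ≠ 0)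
    (hP : DifferentiableAt ℝ (coordProfile w p) (pt (n := n) p, len g v)) (q : Fin n) :
    spatialGrad g X p v q = fderiv ℝ (coordProfile w p) (pt (n := n) p, len g v) (e q, 0) := by
  have hv' := vec_ne_zero hv
  have hG : ∀ i j, DifferentiableAt ℝ (fun x => gram g p x i j) (pt p) := fun i j =>
    (contDiffAt_gram g p (pt_mem_target p) i j).differentiableAt (by simp)
  have hl := len_eq g p v
  rw [hl] at hP ⊢
  have key := fderiv_spherical (l := coordFun n) hG (gram_symm g p) (formAt_pos g p hv') hP
    (hw.inCoords_eventuallyEq p hv')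
  have h1 : dx q (inCoords X p) (zpt p v) = _ := key (e q) 0
  have h2 : ∀ b, dv b (inCoords X p) (zpt p v) = _ := fun b => key 0 (e b)
  have h3 := sum_christoffel_mul_formAt g p (vec v) q
  have h4 : (((0 : 𝔼), (0 : ℝ)) : 𝔼 × ℝ) = 0 := rfl
  rw [spatialGrad, h1]
  simp only [h2, h4, map_zero, zero_add]
  have h5 : ∀ u, bilinDeriv (fun i j x => gram g p x i j) (coordFun n) (pt p) 0 u u = 0 := by
    intro u; simp [bilinDeriv]
  have h6 : ∀ u, bilin (fun i j x => gram g p x i j) (coordFun n) (pt p) u 0 = 0 := by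
    intro u; simp [bilin]
  simp only [h5, h6, zero_div, zero_add, add_zero]
  rw [formAt] at h3
  have h7 : ∀ A r : ℝ, ∑ a, ∑ b, comp v a * christoffel g p b q a *
      (A * (form g p (pt p) (vec v) (e b) / r)) =
      A * ((∑ a, ∑ b, vec v a * christoffel g p b q a * form g p (pt p) (vec v) (e b)) / r) := by
    intro A r
    simp only [Finset.sum_div, Finset.mul_sum]
    refine Finset.sum_congr rfl fun a _ => Finset.sum_congr rfl fun b _ => ?_
    rw [show comp v a = vec v a from rfl]
    ring
  rw [h7, h3]
  ring

/-- The velocity Hessian of a spherically symmetric field. -/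
lemma IsProfile.velHessian_eq (hw : IsProfile g X w) {p : M}
    {v : TangentSpace (𝓡 n) p} (hv : v ≠ 0)
    (hP : ContDiffAt ℝ ∞ (coordProfile w p) (pt (n := n) p, len g v)) (i j : Fin n) :
    velHessian X p v i j =
      fderiv ℝ (fun y => fderiv ℝ (coordProfile w p) y (0, 1)) (pt (n := n) p, len g v) (0, 1) *
        (lower g v i * lower g v j) / len g v ^ 2 +
      fderiv ℝ (coordProfile w p) (pt (n := n) p, len g v) (0, 1) *
        (gramAt g p i j / len g v - lower g v i * lower g v j / len g v ^ 3) := by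
  have hv' := vec_ne_zero hv
  have hr := len_pos g p hv
  rw [lower_eq, lower_eq]
  have hl := len_eq g p v
  rw [hl] at hP hr ⊢
  have key : velHessian X p v i j = _ := fderiv_fderiv_spherical (l := coordFun n)
    (contDiffAt_gram g p (pt_mem_target p)) (gram_symm g p) (formAt_pos g p hv') hP
    (hw.inCoords_eventuallyEq p hv') 0 (e i) (e j)
  rw [key]
  have h4 : (((0 : 𝔼), (0 : ℝ)) : 𝔼 × ℝ) = 0 := rfl
  have h5 : ∀ u u', bilinDeriv (fun i j x => gram g p x i j) (coordFun n) (pt p) 0 u u' = 0 := by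
    intro u u'; simp [bilinDeriv]
  have h6 : bilin (fun i j x => gram g p x i j) (coordFun n) (pt p) (e i) (e j) =
      gramAt g p i j := by
    have := formAt_e g p (e i) j
    rw [formAt, form] at this
    rw [this]
    simp only [e, PiLp.single_apply]
    simp [gramAt, gram_symm g p i j]
  simp only [h4, map_zero, zero_add, h5, zero_div, h6]
  simp only [formAt, form] at hr ⊢
  field_simp

/-- The Euler-Lagrange expression of a spherically symmetric function: all Christoffel symbols
cancel. -/
lemma IsProfile.eulerLagrange_eq (hw : IsProfile g X w) (F : ForceField n M) {p : M}
    {v : TangentSpace (𝓡 n) p} (hv : v ≠ 0)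
    (hP : ContDiffAt ℝ ∞ (coordProfile w p) (pt (n := n) p, len g v)) (k : Fin n) :
    eulerLagrange g X F p v k =
      (fderiv ℝ (fun y => fderiv ℝ (coordProfile w p) y (0, 1)) (pt (n := n) p, len g v)
          (vec v, 0) +
        fderiv ℝ (fun y => fderiv ℝ (coordProfile w p) y (0, 1)) (pt (n := n) p, len g v) (0, 1) *
        ((∑ m, comp v m * lower g (F p v) m) / len g v)) * (lower g v k / len g v) +
      fderiv ℝ (coordProfile w p) (pt (n := n) p, len g v) (0, 1) *
        (lower g (F p v) k / len g v -
          lower g v k * (∑ m, comp v m * lower g (F p v) m) / len g v ^ 3) -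
      fderiv ℝ (coordProfile w p) (pt (n := n) p, len g v) (e k, 0) := by
  have hv' := vec_ne_zero hv
  have hr := len_pos g p hv
  set Φ : 𝔼 := WithLp.toLp 2 (newtonField g F p v) with hΦ
  have hlin : ∀ T : 𝔼 × 𝔼 →L[ℝ] ℝ, ∑ s, T (0, e s) * newtonField g F p v s
      + ∑ s, T (e s, 0) * comp v s = T (vec v, Φ) := by
    intro T
    have e1 := clm_eq_sum (T ∘L ContinuousLinearMap.inl ℝ 𝔼 𝔼) (vec v)
    have e2 := clm_eq_sum (T ∘L ContinuousLinearMap.inr ℝ 𝔼 𝔼) Φ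
    simp only [ContinuousLinearMap.comp_apply, ContinuousLinearMap.inl_apply,
      ContinuousLinearMap.inr_apply] at e1 e2
    have e3 : ((vec v, Φ) : 𝔼 × 𝔼) = (vec v, 0) + (0, Φ) := by simp
    rw [e3, map_add, e1, e2, add_comm]
    congr 1 <;> refine Finset.sum_congr rfl fun s _ => mul_comm _ _
  have hN : ∀ m, formAt g p Φ (e m) = lower g (F p v) m - formDeriv g p (vec v) (vec v) (e m)
      + formDeriv g p (e m) (vec v) (vec v) / 2 := formAt_newtonField g F p v
  -- the pairing of the vertical part with the velocity
  have hNv : formAt g p (vec v) Φ = ∑ m, comp v m * lower g (F p v) m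
      - formDeriv g p (vec v) (vec v) (vec v) / 2 := by
    have e1 := formDeriv_eq_sum_right g p (vec v) (vec v) (vec v)
    have e2 := formDeriv_eq_sum_left g p (vec v) (vec v) (vec v)
    rw [formAt, form_symm, ← formAt, formAt_eq_sum]
    simp only [hN, mul_add, mul_sub, Finset.sum_add_distrib, Finset.sum_sub_distrib, ← e1]
    have e3 : ∑ m, vec v m * (formDeriv g p (e m) (vec v) (vec v) / 2) =
        formDeriv g p (vec v) (vec v) (vec v) / 2 := by
      rw [e2, Finset.sum_div]
      exact Finset.sum_congr rfl fun m _ => by rw [mul_div_assoc]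
    rw [e3]
    have e4 : ∑ m, vec v m * lower g (F p v) m = ∑ m, comp v m * lower g (F p v) m := rfl
    rw [e4]
    ring
  have hl := len_eq g p v
  rw [lower_eq g p v]
  rw [hl] at hP hr ⊢
  have key1 := fderiv_fderiv_spherical (l := coordFun n)
    (contDiffAt_gram g p (pt_mem_target p)) (gram_symm g p) (formAt_pos g p hv') hP
    (hw.inCoords_eventuallyEq p hv') (vec v) Φ (e k)
  have key2 : dx k (inCoords X p) (zpt p v) = _ := fderiv_spherical (l := coordFun n)
    (fun i j => (contDiffAt_gram g p (pt_mem_target p) i j).differentiableAt (by simp))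
    (gram_symm g p) (formAt_pos g p hv') (hP.differentiableAt (by simp))
    (hw.inCoords_eventuallyEq p hv') (e k) 0
  have h6 : bilin (fun i j x => gram g p x i j) (coordFun n) (pt p) (vec v) 0 = 0 := by
    simp [bilin]
  rw [h6, add_zero] at key2
  have hNk := hN k
  have key3 : eulerLagrange g X F p v k =
      fderiv ℝ (fun z => fderiv ℝ (inCoords X p) z (0, e k)) (pt (n := n) p, vec v) (vec v, Φ)
        - dx k (inCoords X p) (zpt p v) := by
    rw [← hlin]; rfl
  rw [key3, key1, key2]
  simp only [formAt, form, formDeriv] at hr hNk hNv ⊢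
  rw [hNk, hNv]
  field_simp
  ring

end Profile

/-! ### Necessity: the Euler-Lagrange equations force a conformal force field -/

/-- If `P_x = P_r b` and `P_{rx} = P_{rr} b + P_r b / r`, then `b = P_x / P_r` is linear in `r`:
by the symmetry of the second derivative, `b / r` has derivative zero. -/
lemma ratio_linear {E : Type*} [NormedAddCommGroup E] [NormedSpace ℝ E] {P : E × ℝ → ℝ} {x a : E}
    (hP : ∀ r, 0 < r → ContDiffAt ℝ ∞ P (x, r))
    (h0 : ∀ r, 0 < r → fderiv ℝ P (x, r) (0, 1) ≠ 0)
    (h : ∀ r, 0 < r → fderiv ℝ (fun y => fderiv ℝ P y (0, 1)) (x, r) (a, 0) =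
      fderiv ℝ (fun y => fderiv ℝ P y (0, 1)) (x, r) (0, 1) *
        (fderiv ℝ P (x, r) (a, 0) / fderiv ℝ P (x, r) (0, 1)) + fderiv ℝ P (x, r) (a, 0) / r)
    {r : ℝ} (hr : 0 < r) :
    fderiv ℝ P (x, r) (a, 0) / fderiv ℝ P (x, r) (0, 1) =
      r * (fderiv ℝ P (x, 1) (a, 0) / fderiv ℝ P (x, 1) (0, 1)) := by
  have hd : ∀ c : E × ℝ, ∀ s, 0 < s → HasDerivAt (fun s : ℝ => fderiv ℝ P (x, s) c)
      (fderiv ℝ (fun y => fderiv ℝ P y c) (x, s) (0, 1)) s := by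
    intro c s hs
    have h1 : HasDerivAt (fun s : ℝ => (x, s)) ((0 : E), (1 : ℝ)) s :=
      (hasDerivAt_const s x).prodMk (hasDerivAt_id s)
    have h2 : ContDiffAt ℝ 1 (fderiv ℝ P) (x, s) := (hP s hs).fderiv_right (by norm_cast)
    have h3 : DifferentiableAt ℝ (fun y => fderiv ℝ P y c) (x, s) :=
      (h2.clm_apply contDiffAt_const).differentiableAt (by simp)
    exact h3.hasFDerivAt.comp_hasDerivAt s h1
  have hsymm : ∀ s, 0 < s → fderiv ℝ (fun y => fderiv ℝ P y (a, 0)) (x, s) (0, 1) =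
      fderiv ℝ (fun y => fderiv ℝ P y (0, 1)) (x, s) (a, 0) := by
    intro s hs
    have h2 : ContDiffAt ℝ 1 (fderiv ℝ P) (x, s) := (hP s hs).fderiv_right (by norm_cast)
    have h3 : DifferentiableAt ℝ (fderiv ℝ P) (x, s) := h2.differentiableAt (by simp)
    have h4 : IsSymmSndFDerivAt ℝ P (x, s) := (hP s hs).isSymmSndFDerivAt (by simp; norm_cast)
    have h5 : ∀ c d : E × ℝ, fderiv ℝ (fun y => fderiv ℝ P y c) (x, s) d =
        fderiv ℝ (fderiv ℝ P) (x, s) d c := by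
      intro c d
      rw [(h3.hasFDerivAt.clm_apply (hasFDerivAt_const c (x, s))).fderiv]
      simp
    rw [h5, h5]
    exact h4 _ _
  have hder : ∀ s ∈ Ioi (0 : ℝ), HasDerivAt
      (fun s => fderiv ℝ P (x, s) (a, 0) / (s * fderiv ℝ P (x, s) (0, 1))) 0 s := by
    intro s hs
    have hs' : s ≠ 0 := (mem_Ioi.1 hs).ne'
    have h1 := (hd (a, 0) s hs).fun_div ((hasDerivAt_id' s).mul (hd (0, 1) s hs))
      (mul_ne_zero hs' (h0 s hs))
    refine h1.congr_deriv ?_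
    have := h0 s hs
    simp only [Pi.mul_apply]
    rw [hsymm s hs, h s hs]
    field_simp
    ring
  have hc := IsOpen.is_const_of_deriv_eq_zero isOpen_Ioi isPreconnected_Ioi
    (fun s hs => (hder s hs).differentiableAt.differentiableWithinAt)
    (fun s hs => (hder s hs).deriv) (mem_Ioi.2 hr) (mem_Ioi.2 one_pos)
  simp only [one_mul] at hc
  rw [← hc]
  have := h0 r hr
  field_simp

/-- In dimension at least two every vector has a nonzero orthogonal vector. -/
lemma exists_orthogonal (hn : 2 ≤ n) (g : Metric n M) (p : M) (v : 𝔼) :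
    ∃ u : 𝔼, u ≠ 0 ∧ formAt g p u v = 0 := by
  set i : Fin n := ⟨0, by omega⟩
  set j : Fin n := ⟨1, by omega⟩
  have hij : i ≠ j := by simp [i, j]
  have hlin : ∀ a b : ℝ, formAt g p (a • e i + b • e j) v =
      a * formAt g p v (e i) + b * formAt g p v (e j) := by
    intro a b
    rw [formAt, form_symm, ← formAt, formAt_eq_sum]
    simp only [PiLp.add_apply, PiLp.smul_apply, e, PiLp.single_apply, smul_eq_mul, add_mul,
      Finset.sum_add_distrib]
    simp
  have hne : ∀ a b : ℝ, a ≠ 0 ∨ b ≠ 0 → (a • e i + b • e j : 𝔼) ≠ 0 := by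
    intro a b hab h
    have h1 := congrArg (fun u : 𝔼 => u i) h
    have h2 := congrArg (fun u : 𝔼 => u j) h
    simp [e, hij, hij.symm] at h1 h2
    exact hab.elim (fun h => h h1) fun h => h h2
  by_cases h : formAt g p v (e i) = 0
  · exact ⟨(1 : ℝ) • e i + (0 : ℝ) • e j, hne _ _ (Or.inl one_ne_zero), by rw [hlin, h]; simp⟩
  · exact ⟨formAt g p v (e j) • e i + (-formAt g p v (e i)) • e j,
      hne _ _ (Or.inr (neg_ne_zero.2 h)), by rw [hlin]; ring⟩

/-- Every vector can be rescaled to a prescribed length. -/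
lemma exists_smul_len_eq (g : Metric n M) (p : M) {u : 𝔼} (hu : u ≠ 0) {r : ℝ} (hr : 0 < r) :
    ∃ a : ℝ, 0 < a ∧ len g (ofVec p (a • u)) = r ∧ ofVec p (a • u) ≠ 0 := by
  have hl : 0 < len g (ofVec p u) := len_pos g p hu
  have ha : 0 < r / len g (ofVec p u) := div_pos hr hl
  refine ⟨r / len g (ofVec p u), ha, ?_, smul_ne_zero ha.ne' hu⟩
  have := len_smul g (ofVec p u) ha.le
  rw [div_mul_cancel₀ _ hl.ne'] at this
  exact this

lemma sum_comp_mul_lower (g : Metric n M) (p : M) (v : TangentSpace (𝓡 n) p) :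
    ∑ m, comp v m * lower g v m = len g v ^ 2 := by
  rw [len_sq, formAt_eq_sum]
  exact Finset.sum_congr rfl fun m _ => by rw [lower_eq]; rfl

/-- The covariant components of `shiftForce`, with `b_s = ∇_s W / W'`. -/
lemma lower_shiftForce (g : Metric n M) (W : TangentBundle (𝓡 n) M → ℝ) (p : M)
    {v : TangentSpace (𝓡 n) p} (hv : v ≠ 0) (k : Fin n) :
    lower g (shiftForce g W p v) k =
      len g v * (spatialGrad g W p v k / radialDeriv g W p v) -
        2 * (∑ s, spatialGrad g W p v s / radialDeriv g W p v * comp v s) / len g v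
          * lower g v k := by
  have hr := (len_pos g p hv).ne'
  rw [shiftForce, lower_raise]
  simp only [mul_sub, Finset.sum_sub_distrib, mul_ite, mul_one, mul_zero, Finset.sum_ite_eq',
    Finset.mem_univ, if_true]
  have : ∑ s, spatialGrad g W p v s / radialDeriv g W p v *
      (2 * comp v s * lower g v k / len g v ^ 2) =
      2 * (∑ s, spatialGrad g W p v s / radialDeriv g W p v * comp v s) / len g v ^ 2
        * lower g v k := by
    rw [Finset.mul_sum, Finset.sum_div, Finset.sum_mul]
    exact Finset.sum_congr rfl fun s _ => by ring
  rw [this]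
  field_simp
  ring

lemma sum_comp_mul_lower_shiftForce (g : Metric n M) (W : TangentBundle (𝓡 n) M → ℝ) (p : M)
    {v : TangentSpace (𝓡 n) p} (hv : v ≠ 0) :
    ∑ m, comp v m * lower g (shiftForce g W p v) m =
      -(len g v * ∑ s, spatialGrad g W p v s / radialDeriv g W p v * comp v s) := by
  have hr := (len_pos g p hv).ne'
  have h := sum_comp_mul_lower g p v
  set β := ∑ s, spatialGrad g W p v s / radialDeriv g W p v * comp v s with hβ
  have h1 : ∑ m, comp v m * lower g (shiftForce g W p v) m =
      len g v * β - 2 * β / len g v * ∑ m, comp v m * lower g v m := by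
    rw [hβ, Finset.mul_sum, Finset.mul_sum, ← Finset.sum_sub_distrib]
    refine Finset.sum_congr rfl fun m _ => ?_
    rw [lower_shiftForce g W p hv]
    ring
  rw [h1, h]
  field_simp
  ring

/-- A regular spherically symmetric function has nonzero radial derivative: otherwise its velocity
Hessian has rank at most one. -/
lemma IsProfile.radial_ne_zero (hn : 2 ≤ n) {g : Metric n M} {L : TangentBundle (𝓡 n) M → ℝ}
    {w : M → ℝ → ℝ} (hw : IsProfile g L w) {p : M} {v : TangentSpace (𝓡 n) p} (hv : v ≠ 0)
    (hP : ContDiffAt ℝ ∞ (coordProfile w p) (pt (n := n) p, len g v))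
    (hdet : (velHessian L p v).det ≠ 0) :
    fderiv ℝ (coordProfile w p) (pt (n := n) p, len g v) (0, 1) ≠ 0 := by
  intro h0
  obtain ⟨u, hu0, hu⟩ := exists_orthogonal hn g p (vec v)
  refine hdet (Matrix.exists_mulVec_eq_zero_iff.1 ⟨fun k => u k, ?_, ?_⟩)
  · intro h
    exact hu0 (PiLp.ext fun k => congrFun h k)
  · funext i
    rw [formAt, form_symm, ← formAt, formAt_eq_sum] at hu
    simp only [Matrix.mulVec, dotProduct, hw.velHessian_eq hv hP, h0, zero_mul, add_zero,
      Pi.zero_apply]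
    have : ∀ j, fderiv ℝ (fun y => fderiv ℝ (coordProfile w p) y (0, 1))
        (pt (n := n) p, len g v) (0, 1) * (lower g v i * lower g v j) / len g v ^ 2 * u j =
        fderiv ℝ (fun y => fderiv ℝ (coordProfile w p) y (0, 1))
        (pt (n := n) p, len g v) (0, 1) * lower g v i / len g v ^ 2 *
          (u j * formAt g p (vec v) (e j)) := by
      intro j; rw [lower_eq g p v j]; ring
    simp only [this, ← Finset.mul_sum, hu, mul_zero]

/-- The Euler-Lagrange equations along `shiftForce g W` for a spherically symmetric `L` make the
quotient `∇_k W / W'` a linear function of `r`. -/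
lemma quotient_linear (hn : 2 ≤ n) {g : Metric n M} {W L : TangentBundle (𝓡 n) M → ℝ}
    {w ℓ : M → ℝ → ℝ} (hW : SmoothOnSlit W) (hw : IsProfile g W w)
    (hL : IsLagrangeFunction g (shiftForce g W) L) (hl : IsProfile g L ℓ) (p : M) (k : Fin n)
    {r : ℝ} (hr : 0 < r) :
    fderiv ℝ (coordProfile w p) (pt (n := n) p, r) (e k, 0) / deriv (w p) r =
      r * (fderiv ℝ (coordProfile w p) (pt (n := n) p, 1) (e k, 0) / deriv (w p) 1) := by
  have hn0 : 0 < n := by omega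
  have hPw : ∀ r, 0 < r → ContDiffAt ℝ ∞ (coordProfile w p) (pt (n := n) p, r) := fun r hr =>
    hw.contDiffAt hn0 hW p (pt_mem_target p) hr
  have hPl : ∀ r, 0 < r → ContDiffAt ℝ ∞ (coordProfile ℓ p) (pt (n := n) p, r) := fun r hr =>
    hl.contDiffAt hn0 hL.smooth p (pt_mem_target p) hr
  set P : 𝔼 × ℝ → ℝ := coordProfile ℓ p with hP
  set b : Fin n → ℝ → ℝ := fun s r =>
    fderiv ℝ (coordProfile w p) (pt (n := n) p, r) (e s, 0) / deriv (w p) r with hb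
  have he0 : ∀ k : Fin n, (e k : 𝔼) ≠ 0 := fun k h => by
    have := congrArg (fun u : 𝔼 => u k) h
    simp [e] at this
  have hPr : ∀ r, 0 < r → fderiv ℝ P (pt (n := n) p, r) (0, 1) ≠ 0 := by
    intro r hr
    obtain ⟨a, -, ha, ha0⟩ := exists_smul_len_eq g p (he0 ⟨0, hn0⟩) hr
    have := hl.radial_ne_zero hn ha0 (by rw [ha]; exact hPl r hr) (hL.regular p _ ha0)
    rwa [ha] at this
  -- the Euler-Lagrange equations: on the sphere of radius `r` the left-hand side does not depend
  -- on `v`, and the right-hand side is proportional to `v_k`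
  have hEL : ∀ r, 0 < r → ∀ v : TangentSpace (𝓡 n) p, v ≠ 0 → len g v = r → ∀ k,
      fderiv ℝ P (pt (n := n) p, r) (e k, 0) - fderiv ℝ P (pt (n := n) p, r) (0, 1) * b k r =
      (fderiv ℝ (fun y => fderiv ℝ P y (0, 1)) (pt (n := n) p, r) (vec v, 0)
        - (fderiv ℝ (fun y => fderiv ℝ P y (0, 1)) (pt (n := n) p, r) (0, 1)
          + fderiv ℝ P (pt (n := n) p, r) (0, 1) / r) * ∑ s, b s r * comp v s)
        / r ^ 2 * lower g v k * r := by
    rintro r hr v hv rfl k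
    have h1 := hL.euler_lagrange p v hv k
    have hbv : ∀ s, spatialGrad g W p v s / radialDeriv g W p v = b s (len g v) := fun s => by
      rw [hw.spatialGrad_eq hv ((hPw _ hr).differentiableAt (by simp)), hw.radialDeriv_eq hv]
    rw [hl.eulerLagrange_eq _ hv (hPl _ hr), sum_comp_mul_lower_shiftForce g W p hv,
      lower_shiftForce g W p hv] at h1
    simp only [hbv] at h1
    rw [← hP] at h1
    refine eq_of_sub_eq_zero (neg_eq_zero.1 (Eq.trans ?_ h1))
    field_simp
    ring
  -- for `v` orthogonal to `e_k` the right-hand side vanishes, hence so does the left-hand side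
  have hx : ∀ r, 0 < r → ∀ k, fderiv ℝ P (pt (n := n) p, r) (e k, 0) =
      fderiv ℝ P (pt (n := n) p, r) (0, 1) * b k r := by
    intro r hr k
    obtain ⟨u, hu0, hu⟩ := exists_orthogonal hn g p (e k)
    obtain ⟨a, -, ha, ha0⟩ := exists_smul_len_eq g p hu0 hr
    have h1 := hEL r hr _ ha0 ha k
    have h2 : lower g (ofVec p (a • u)) k = 0 := by
      rw [lower_eq]
      have : formAt g p (a • u) (e k) = a * formAt g p u (e k) := by
        simp only [formAt_e, PiLp.smul_apply, smul_eq_mul, Finset.mul_sum]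
        exact Finset.sum_congr rfl fun _ _ => by ring
      exact this.trans (by rw [hu, mul_zero])
    rw [h2, mul_zero, zero_mul] at h1
    linarith
  -- now the coefficient of `v_m` vanishes for every `v`; it is evaluated at a multiple of `e_k`
  have hrx : ∀ r, 0 < r → ∀ k,
      fderiv ℝ (fun y => fderiv ℝ P y (0, 1)) (pt (n := n) p, r) (e k, 0) =
      (fderiv ℝ (fun y => fderiv ℝ P y (0, 1)) (pt (n := n) p, r) (0, 1)
          + fderiv ℝ P (pt (n := n) p, r) (0, 1) / r) * b k r := by
    intro r hr k
    obtain ⟨a, ha1, ha, ha0⟩ := exists_smul_len_eq g p (he0 k) hr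
    have hr2 : ∑ m, comp (ofVec p (a • e k)) m * lower g (ofVec p (a • e k)) m = r ^ 2 := by
      rw [sum_comp_mul_lower, ha]
    obtain ⟨m, hm⟩ : ∃ m, lower g (ofVec p (a • e k)) m ≠ 0 := by
      by_contra hcon
      push Not at hcon
      simp only [hcon, mul_zero, Finset.sum_const_zero] at hr2
      exact (pow_pos hr 2).ne hr2
    have h1 := hEL r hr _ ha0 ha m
    rw [hx r hr m, sub_self] at h1
    have h2 : ((vec (ofVec p (a • e k)), 0) : 𝔼 × ℝ) = a • ((e k, 0) : 𝔼 × ℝ) := by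
      simp [vec, ofVec]
    have h3 : ∑ s, b s r * comp (ofVec p (a • e k)) s = a * b k r := by
      have : ∀ s, comp (ofVec p (a • e k)) s = a * if s = k then 1 else 0 := by
        intro s
        change (a • (e k : 𝔼)) s = _
        simp [e]
      simp [this, mul_comm]
    rw [h2, h3, map_smul, smul_eq_mul] at h1
    have h4 := (mul_eq_zero.1 ((mul_eq_zero.1 h1.symm).resolve_right hr.ne')).resolve_right hm
    have h5 := (div_eq_zero_iff.1 h4).resolve_right (pow_pos hr 2).ne'
    have h6 : a * (fderiv ℝ (fun y => fderiv ℝ P y (0, 1)) (pt (n := n) p, r) (e k, 0) -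
      (fderiv ℝ (fun y => fderiv ℝ P y (0, 1)) (pt (n := n) p, r) (0, 1)
          + fderiv ℝ P (pt (n := n) p, r) (0, 1) / r) * b k r) = 0 := by linarith
    exact sub_eq_zero.1 ((mul_eq_zero.1 h6).resolve_left ha1.ne')
  have hbP : ∀ r, 0 < r → b k r =
      fderiv ℝ P (pt (n := n) p, r) (e k, 0) / fderiv ℝ P (pt (n := n) p, r) (0, 1) := by
    intro r hr
    rw [hx r hr k, mul_div_cancel_left₀ _ (hPr r hr)]
  have := ratio_linear hPl hPr (a := (e k : 𝔼)) (fun r hr => by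
    rw [← hbP r hr, hrx r hr k, hx r hr k]; ring) hr
  rw [← hbP r hr, ← hbP 1 one_pos] at this
  exact this

/-! ### The potential -/

section Transport

variable {E : Type*} [NormedAddCommGroup E] [NormedSpace ℝ E]

lemma hasFDerivAt_slice {P : E × ℝ → ℝ} {x : E} {s : ℝ} (h : DifferentiableAt ℝ P (x, s)) :
    HasFDerivAt (fun y => P (y, s)) (fderiv ℝ P (x, s) ∘L ContinuousLinearMap.inl ℝ E ℝ) x :=
  HasFDerivAt.comp x (f := fun y : E => (y, s)) h.hasFDerivAt (hasFDerivAt_prodMk_left x s)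

/-- If `P_x = r P_r α`, then `P` is constant along the curve that lies over a segment and has
`s - ∫ α` as the logarithm of its radius. -/
lemma eq_of_segment {K : Set E} (hK : Convex ℝ K) (hKo : IsOpen K) {P : E × ℝ → ℝ}
    {α : E → E →L[ℝ] ℝ} (hα : ContinuousOn α K)
    (hP : ∀ x ∈ K, ∀ r, 0 < r → DifferentiableAt ℝ P (x, r))
    (h : ∀ x ∈ K, ∀ r, 0 < r → ∀ ξ, fderiv ℝ P (x, r) (ξ, 0) =
      r * fderiv ℝ P (x, r) (0, 1) * α x ξ)
    {x₀ x₁ : E} (h₀ : x₀ ∈ K) (h₁ : x₁ ∈ K) (s : ℝ) :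
    P (x₁, Real.exp (s - ∫ t in (0 : ℝ)..1, α (AffineMap.lineMap x₀ x₁ t) (x₁ - x₀))) =
      P (x₀, Real.exp s) := by
  set c : ℝ →ᵃ[ℝ] E := AffineMap.lineMap x₀ x₁ with hc
  have hcd : ∀ t, HasDerivAt c (x₁ - x₀) t := fun t => AffineMap.hasDerivAt_lineMap
  have hcc : Continuous c := AffineMap.lineMap_continuous
  set O : Set ℝ := c ⁻¹' K with hO
  have hOo : IsOpen O := hKo.preimage hcc
  have hOc : Convex ℝ O := hK.affine_preimage c
  have hO0 : (0 : ℝ) ∈ O := by simp [hO, hc, h₀]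
  have hO1 : (1 : ℝ) ∈ O := by simp [hO, hc, h₁]
  set φ : ℝ → ℝ := fun t => α (c t) (x₁ - x₀) with hφ
  have hφc : ContinuousOn φ O :=
    (hα.comp hcc.continuousOn fun t ht => ht).clm_apply continuousOn_const
  have hA : ∀ t ∈ O, HasDerivAt (fun t => ∫ τ in (0 : ℝ)..t, φ τ) (φ t) t := by
    intro t ht
    refine intervalIntegral.integral_hasDerivAt_right ?_
      (hφc.stronglyMeasurableAtFilter hOo t ht) (hφc.continuousAt (hOo.mem_nhds ht))
    refine (hφc.mono ?_).intervalIntegrable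
    exact hOc.ordConnected.uIcc_subset hO0 ht
  have hder : ∀ t ∈ O, HasDerivAt
      (fun t => P (c t, Real.exp (s - ∫ τ in (0 : ℝ)..t, φ τ))) 0 t := by
    intro t ht
    have h1 : HasDerivAt (fun t => (c t, Real.exp (s - ∫ τ in (0 : ℝ)..t, φ τ))) _ t :=
      (hcd t).prodMk (((hA t ht).const_sub s).exp)
    have hpos := Real.exp_pos (s - ∫ τ in (0 : ℝ)..t, φ τ)
    refine ((hP (c t) ht _ hpos).hasFDerivAt.comp_hasDerivAt t h1).congr_deriv ?_
    have h2 : ∀ a : ℝ, ((x₁ - x₀, a) : E × ℝ) = (x₁ - x₀, 0) + a • ((0, 1) : E × ℝ) := fun a => by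
      ext <;> simp
    rw [h2, map_add, map_smul, h (c t) ht _ hpos, smul_eq_mul]
    simp only [hφ]
    ring
  have := IsOpen.is_const_of_deriv_eq_zero hOo hOc.isPreconnected
    (fun t ht => (hder t ht).differentiableAt.differentiableWithinAt)
    (fun t ht => (hder t ht).deriv) hO1 hO0
  simpa [hc] using this

end Transport

/-- If `∇_k w / w' = r a_k` in the preferred chart at every point, then the same holds in every
chart, at every point of it: the derivative `T` of the transition map acts on both sides alike. -/
lemma fderiv_coordProfile_of_linear {w : M → ℝ → ℝ}
    (hw : ∀ (c : M), ∀ x ∈ (extChartAt (𝓡 n) c).target, ∀ r, 0 < r →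
      ContDiffAt ℝ ∞ (coordProfile w c) (x, r))
    (hne : ∀ p r, 0 < r → deriv (w p) r ≠ 0)
    (hlin : ∀ p k r, 0 < r →
      fderiv ℝ (coordProfile w p) (pt (n := n) p, r) (e k, 0) / deriv (w p) r =
        r * (fderiv ℝ (coordProfile w p) (pt (n := n) p, 1) (e k, 0) / deriv (w p) 1))
    (c : M) {x : 𝔼} (hx : x ∈ (extChartAt (𝓡 n) c).target) {r : ℝ} (hr : 0 < r) (ξ : 𝔼) :
    fderiv ℝ (coordProfile w c) (x, r) (ξ, 0) = r * fderiv ℝ (coordProfile w c) (x, r) (0, 1) *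
      (fderiv ℝ (coordProfile w c) (x, 1) (ξ, 0) /
        fderiv ℝ (coordProfile w c) (x, 1) (0, 1)) := by
  set q := (extChartAt (𝓡 n) c).symm x with hq
  have hxq : extChartAt (𝓡 n) c q = x := (extChartAt (𝓡 n) c).right_inv hx
  have hqs : q ∈ (extChartAt (𝓡 n) c).source := (extChartAt (𝓡 n) c).map_target hx
  obtain ⟨T, hT⟩ : ∃ T : 𝔼 →L[ℝ] 𝔼,
      HasFDerivAt (extChartAt (𝓡 n) q ∘ (extChartAt (𝓡 n) c).symm) T x := by
    have := hasFDerivWithinAt_tangentCoordChange (I := 𝓡 n) (x := c) (y := q) (z := q)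
      ⟨hqs, mem_extChartAt_source q⟩
    rw [ModelWithCorners.range_eq_univ, hasFDerivWithinAt_univ, hxq] at this
    exact ⟨_, this⟩
  have hd : ∀ s, 0 < s → ∀ η, fderiv ℝ (coordProfile w c) (x, s) (η, 0) =
      fderiv ℝ (coordProfile w q) (pt (n := n) q, s) (T η, 0) := by
    intro s hs η
    have h2 : HasFDerivAt (fun y : 𝔼 => coordProfile w c (y, s))
        ((fderiv ℝ (coordProfile w c) (x, s)) ∘L ContinuousLinearMap.inl ℝ 𝔼 ℝ) x :=
      hasFDerivAt_slice ((hw c x hx s hs).differentiableAt (by simp))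
    have h3 : HasFDerivAt (fun y : 𝔼 => coordProfile w q
        ((extChartAt (𝓡 n) q ∘ (extChartAt (𝓡 n) c).symm) y, s))
        ((fderiv ℝ (coordProfile w q) (pt (n := n) q, s)) ∘L
          (ContinuousLinearMap.inl ℝ 𝔼 ℝ ∘L T)) x := by
      have h4 : HasFDerivAt (fun y : 𝔼 =>
          ((extChartAt (𝓡 n) q ∘ (extChartAt (𝓡 n) c).symm) y, s))
          (ContinuousLinearMap.inl ℝ 𝔼 ℝ ∘L T) x :=
        (hasFDerivAt_prodMk_left _ s).comp x hT
      have h5 := ((hw q (pt q) (pt_mem_target q) s hs).differentiableAt (by simp)).hasFDerivAt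
      exact h5.comp x h4
    have h6 : (fun y : 𝔼 => coordProfile w c (y, s)) =ᶠ[𝓝 x] fun y : 𝔼 => coordProfile w q
        ((extChartAt (𝓡 n) q ∘ (extChartAt (𝓡 n) c).symm) y, s) := by
      have h7 : ∀ᶠ y in 𝓝 x, (extChartAt (𝓡 n) c).symm y ∈ (extChartAt (𝓡 n) q).source := by
        have : ContinuousAt (extChartAt (𝓡 n) c).symm x :=
          (continuousOn_extChartAt_symm c).continuousAt
            ((isOpen_extChartAt_target c).mem_nhds hx)
        exact this.eventually (extChartAt_source_mem_nhds q)
      filter_upwards [h7] with y hy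
      simp only [coordProfile, Function.comp_apply, (extChartAt (𝓡 n) q).left_inv hy]
    have h8 := (h3.congr_of_eventuallyEq h6).unique h2
    exact (congrArg (fun A : 𝔼 →L[ℝ] ℝ => A η) h8).symm
  have hr' : ∀ s, 0 < s → fderiv ℝ (coordProfile w c) (x, s) (0, 1) = deriv (w q) s := fun s hs =>
    (hasDerivAt_profile ((hw c x hx s hs).differentiableAt (by simp))).deriv.symm
  have hlin' : ∀ η : 𝔼, fderiv ℝ (coordProfile w q) (pt (n := n) q, r) (η, 0) =
      r * deriv (w q) r / deriv (w q) 1 *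
        fderiv ℝ (coordProfile w q) (pt (n := n) q, 1) (η, 0) := by
    intro η
    have e1 := clm_eq_sum (fderiv ℝ (coordProfile w q) (pt (n := n) q, r) ∘L
      ContinuousLinearMap.inl ℝ 𝔼 ℝ) η
    have e2 := clm_eq_sum (fderiv ℝ (coordProfile w q) (pt (n := n) q, 1) ∘L
      ContinuousLinearMap.inl ℝ 𝔼 ℝ) η
    simp only [ContinuousLinearMap.comp_apply, ContinuousLinearMap.inl_apply] at e1 e2
    rw [e1, e2, Finset.mul_sum]
    refine Finset.sum_congr rfl fun k _ => ?_
    have h1 := hlin q k r hr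
    have h2 := hne q r hr
    have h3 := hne q 1 one_pos
    field_simp at h1 ⊢
    rw [h1]
  rw [hd r hr, hd 1 one_pos, hr' r hr, hr' 1 one_pos, hlin']
  ring

/-- A profile `w` with `w' ≠ 0` and `∇_k w / w' = r a_k` comes from a potential: there is a smooth
`f`, defined on all of `M`, with `∇ f = -a`, namely the logarithm of the radius at which `w` takes a
value that is locally constant in the position. -/
lemma exists_potential {w : M → ℝ → ℝ}
    (hw : ∀ (c : M), ∀ x ∈ (extChartAt (𝓡 n) c).target, ∀ r, 0 < r →
      ContDiffAt ℝ ∞ (coordProfile w c) (x, r))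
    (hne : ∀ p r, 0 < r → deriv (w p) r ≠ 0)
    (hlin : ∀ p k r, 0 < r →
      fderiv ℝ (coordProfile w p) (pt (n := n) p, r) (e k, 0) / deriv (w p) r =
        r * (fderiv ℝ (coordProfile w p) (pt (n := n) p, 1) (e k, 0) / deriv (w p) 1)) :
    ∃ f : M → ℝ, ContMDiff (𝓡 n) 𝓘(ℝ) ∞ f ∧ ∀ p k, grad (n := n) f p k =
      -(fderiv ℝ (coordProfile w p) (pt (n := n) p, 1) (e k, 0) / deriv (w p) 1) := by
  -- by Rolle's theorem every profile is injective on the positive half-line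
  have hdiff : ∀ p r, 0 < r → DifferentiableAt ℝ (w p) r := fun p r hr =>
    differentiableAt_of_deriv_ne_zero (hne p r hr)
  have hlt : ∀ p r s, 0 < r → r < s → w p r ≠ w p s := by
    intro p r s hr hrs heq
    obtain ⟨t, ht, ht0⟩ := exists_deriv_eq_zero hrs
      (fun t ht => (hdiff p t (hr.trans_le ht.1)).continuousAt.continuousWithinAt) heq
    exact hne p t (hr.trans ht.1) ht0
  have hinj : ∀ p s t, w p (Real.exp s) = w p (Real.exp t) → s = t := by
    intro p s t h
    rcases lt_trichotomy s t with hst | hst | hst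
    · exact absurd h (hlt p _ _ (Real.exp_pos s) (Real.exp_lt_exp.2 hst))
    · exact hst
    · exact absurd h.symm (hlt p _ _ (Real.exp_pos t) (Real.exp_lt_exp.2 hst))
  -- The range of `w p` is locally constant in `p`, so a value of `w p` chosen as a function of its
  -- range is locally constant, too.  This makes `f` global without a condition on the topology
  -- of `M`.
  set R : M → Set ℝ := fun p => range fun s => w p (Real.exp s) with hR
  set κ : Set ℝ → ℝ := fun S => Classical.epsilon fun y => y ∈ S with hκ
  have hex : ∀ p, ∃ s, w p (Real.exp s) = κ (R p) := fun p =>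
    Classical.epsilon_spec (p := fun y => y ∈ R p) ⟨_, mem_range_self 0⟩
  choose f hf using hex
  set α : M → 𝔼 → 𝔼 →L[ℝ] ℝ := fun c x =>
    (fderiv ℝ (coordProfile w c) (x, 1) (0, 1))⁻¹ •
      fderiv ℝ (fun y => coordProfile w c (y, 1)) x with hαdef
  have hα_apply : ∀ c, ∀ x ∈ (extChartAt (𝓡 n) c).target, ∀ ξ, α c x ξ =
      fderiv ℝ (coordProfile w c) (x, 1) (ξ, 0) /
        fderiv ℝ (coordProfile w c) (x, 1) (0, 1) := by
    intro c x hx ξ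
    have h2 : HasFDerivAt (fun y : 𝔼 => coordProfile w c (y, 1))
        ((fderiv ℝ (coordProfile w c) (x, 1)) ∘L ContinuousLinearMap.inl ℝ 𝔼 ℝ) x :=
      hasFDerivAt_slice ((hw c x hx 1 one_pos).differentiableAt (by simp))
    simp only [hαdef]
    rw [h2.fderiv, smul_apply, ContinuousLinearMap.comp_apply, ContinuousLinearMap.inl_apply,
      smul_eq_mul, div_eq_inv_mul]
  have hradial : ∀ c, ∀ x ∈ (extChartAt (𝓡 n) c).target,
      fderiv ℝ (coordProfile w c) (x, 1) (0, 1) = deriv (w ((extChartAt (𝓡 n) c).symm x)) 1 :=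
    fun c x hx =>
      (hasDerivAt_profile ((hw c x hx 1 one_pos).differentiableAt (by simp))).deriv.symm
  have hα_smooth : ∀ c, ∀ x ∈ (extChartAt (𝓡 n) c).target, ContDiffAt ℝ ∞ (α c) x := by
    intro c x hx
    have h1 : ContDiffAt ℝ ∞ (fun y : 𝔼 => coordProfile w c (y, 1)) x :=
      ContDiffAt.comp x (f := fun y : 𝔼 => (y, (1 : ℝ))) (hw c x hx 1 one_pos)
        (contDiffAt_id.prodMk contDiffAt_const)
    have h2 : ContDiffAt ℝ ∞ (fun y : 𝔼 => fderiv ℝ (coordProfile w c) (y, 1) (0, 1)) x := by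
      have h3 : ContDiffAt ℝ ∞ (fderiv ℝ (coordProfile w c)) (x, (1 : ℝ)) :=
        (hw c x hx 1 one_pos).fderiv_right (by norm_cast)
      exact (ContDiffAt.comp x (f := fun y : 𝔼 => (y, (1 : ℝ))) h3
        (contDiffAt_id.prodMk contDiffAt_const)).clm_apply contDiffAt_const
    have h4 : fderiv ℝ (coordProfile w c) (x, 1) (0, 1) ≠ 0 := by
      rw [hradial c x hx]; exact hne _ 1 one_pos
    exact (h2.inv h4).smul (h1.fderiv_right (by norm_cast))
  -- comparison of `f` at two points of a convex part of a chart
  have hcomp : ∀ c, ∀ K ⊆ (extChartAt (𝓡 n) c).target, Convex ℝ K → IsOpen K →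
      ∀ x₀ ∈ K, ∀ x₁ ∈ K, f ((extChartAt (𝓡 n) c).symm x₁) = f ((extChartAt (𝓡 n) c).symm x₀) -
        ∫ t in (0 : ℝ)..1, α c (AffineMap.lineMap x₀ x₁ t) (x₁ - x₀) := by
    intro c K hKt hK hKo x₀ h₀ x₁ h₁
    have hseg : ∀ s, w ((extChartAt (𝓡 n) c).symm x₁) (Real.exp
        (s - ∫ t in (0 : ℝ)..1, α c (AffineMap.lineMap x₀ x₁ t) (x₁ - x₀))) =
        w ((extChartAt (𝓡 n) c).symm x₀) (Real.exp s) := by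
      intro s
      refine eq_of_segment (P := coordProfile w c) hK hKo
        (fun x hx => (hα_smooth c x (hKt hx)).continuousAt.continuousWithinAt)
        (fun x hx r hr => (hw c x (hKt hx) r hr).differentiableAt (by simp))
        (fun x hx r hr ξ => ?_) h₀ h₁ s
      rw [hα_apply c x (hKt hx)]
      exact fderiv_coordProfile_of_linear hw hne hlin c (hKt hx) hr ξ
    have hRR : R ((extChartAt (𝓡 n) c).symm x₁) = R ((extChartAt (𝓡 n) c).symm x₀) := by
      refine Subset.antisymm ?_ ?_
      · rintro _ ⟨s, rfl⟩
        refine ⟨s + ∫ t in (0 : ℝ)..1, α c (AffineMap.lineMap x₀ x₁ t) (x₁ - x₀), ?_⟩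
        simp only [← hseg, add_sub_cancel_right]
      · rintro _ ⟨s, rfl⟩
        exact ⟨_, hseg s⟩
    refine hinj ((extChartAt (𝓡 n) c).symm x₁) _ _ ?_
    rw [hf, hseg, hf, hRR]
  -- hence `f` has the expected derivative in every chart
  have hderiv : ∀ c, ∀ x ∈ (extChartAt (𝓡 n) c).target,
      HasFDerivAt (fun x => f ((extChartAt (𝓡 n) c).symm x)) (-α c x) x := by
    intro c x hx
    obtain ⟨ε, hε, hball⟩ := Metric.isOpen_iff.1 (isOpen_extChartAt_target c) x hx
    have h1 : HasFDerivAt (fun y => curveIntegral (α c) (.segment x y)) (α c x) x := by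
      refine HasFDerivAt.curveIntegral_segment_source' ?_
      filter_upwards [(isOpen_extChartAt_target c).mem_nhds hx] with y hy
      exact (hα_smooth c y hy).continuousAt
    have h2 := h1.const_sub (f ((extChartAt (𝓡 n) c).symm x))
    refine h2.congr_of_eventuallyEq ?_
    filter_upwards [Metric.ball_mem_nhds x hε] with y hy
    rw [hcomp c _ hball (convex_ball x ε) Metric.isOpen_ball x (Metric.mem_ball_self hε) y hy,
      curveIntegral_segment]
  have hsmooth : ∀ c, ContDiffOn ℝ ∞ (fun x => f ((extChartAt (𝓡 n) c).symm x))
      (extChartAt (𝓡 n) c).target := by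
    intro c
    rw [contDiffOn_infty_iff_fderiv_of_isOpen (isOpen_extChartAt_target c)]
    refine ⟨fun x hx => (hderiv c x hx).differentiableAt.differentiableWithinAt, ?_⟩
    have : ContDiffOn ℝ ∞ (fun x => -α c x) (extChartAt (𝓡 n) c).target := fun x hx =>
      (hα_smooth c x hx).neg.contDiffWithinAt
    exact this.congr fun x hx => (hderiv c x hx).fderiv
  refine ⟨f, fun p => ?_, fun p k => ?_⟩
  · have h1 : ContMDiffAt 𝓘(ℝ, 𝔼) 𝓘(ℝ) ∞ (fun x => f ((extChartAt (𝓡 n) p).symm x))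
        (extChartAt (𝓡 n) p p) :=
      ((hsmooth p).contDiffAt ((isOpen_extChartAt_target p).mem_nhds
        (mem_extChartAt_target p))).contMDiffAt
    refine (h1.comp p contMDiffAt_extChartAt).congr_of_eventuallyEq ?_
    filter_upwards [extChartAt_source_mem_nhds (I := 𝓡 n) p] with q hq
    simp only [Function.comp_apply, (extChartAt (𝓡 n) p).left_inv hq]
  · rw [grad, (hderiv p _ (pt_mem_target p)).fderiv, neg_apply, hα_apply p _ (pt_mem_target p),
      hradial p _ (pt_mem_target p),
      show (extChartAt (𝓡 n) p).symm (pt p) = p from extChartAt_to_inv p]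

/-! ### The kinetic energy of the conformally equivalent metric -/

section Conformal

variable (g : Metric n M) {f : M → ℝ}

/-- The function `f` in the chart at `c`. -/
abbrev coordFunction (f : M → ℝ) (c : M) (x : 𝔼) : ℝ := f ((extChartAt (𝓡 n) c).symm x)

lemma contDiffAt_coordFunction (hf : ContMDiff (𝓡 n) 𝓘(ℝ) ∞ f) (c : M) {x : 𝔼}
    (hx : x ∈ (extChartAt (𝓡 n) c).target) : ContDiffAt ℝ ∞ (coordFunction f c) x := by
  have h : ContMDiffOn 𝓘(ℝ, 𝔼) 𝓘(ℝ) ∞ (coordFunction f c) (extChartAt (𝓡 n) c).target :=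
    hf.comp_contMDiffOn (contMDiffOn_extChartAt_symm c)
  exact (h.contDiffOn x hx).contDiffAt ((isOpen_extChartAt_target c).mem_nhds hx)

omit [IsManifold (𝓡 n) ∞ M] in
lemma fderiv_coordFunction (f : M → ℝ) (p : M) (u : 𝔼) :
    fderiv ℝ (coordFunction f p) (pt (n := n) p) u = ∑ s, grad f p s * u s := by
  rw [clm_eq_sum]
  exact Finset.sum_congr rfl fun s _ => mul_comm _ _

lemma inner_self_eq_len_sq {p : M} (v : TangentSpace (𝓡 n) p) : g.inner p v v = len g v ^ 2 := by
  rw [len_sq, formAt_vec]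

lemma lower_conformalForce (f : M → ℝ) (p : M) (v : TangentSpace (𝓡 n) p) (k : Fin n) :
    lower g (conformalForce g f p v) k =
      -len g v ^ 2 * grad f p k + 2 * (∑ s, grad f p s * comp v s) * lower g v k :=
  lower_raise g p _ k

lemma sum_comp_mul_lower_conformalForce (f : M → ℝ) (p : M) (v : TangentSpace (𝓡 n) p) :
    ∑ m, comp v m * lower g (conformalForce g f p v) m =
      len g v ^ 2 * ∑ s, grad f p s * comp v s := by
  have h := sum_comp_mul_lower g p v
  have h1 : ∑ m, comp v m * lower g (conformalForce g f p v) m =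
      -len g v ^ 2 * (∑ s, grad f p s * comp v s) +
        2 * (∑ s, grad f p s * comp v s) * ∑ m, comp v m * lower g v m := by
    rw [Finset.mul_sum, Finset.mul_sum _ _ (2 * _), ← Finset.sum_add_distrib]
    refine Finset.sum_congr rfl fun m _ => ?_
    rw [lower_conformalForce]
    ring
  rw [h1, h]
  ring

/-- The kinetic energy `e^{-2f} |v|² / 2` of the metric `e^{-2f} g`. -/
def energy (f : M → ℝ) : TangentBundle (𝓡 n) M → ℝ :=
  fun q => Real.exp (-2 * f q.1) * g.inner q.1 q.2 q.2 / 2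

lemma isProfile_energy (f : M → ℝ) :
    IsProfile g (energy g f) fun p r => Real.exp (-2 * f p) * r ^ 2 / 2 := by
  intro p v _
  simp only [energy, inner_self_eq_len_sq]

lemma contMDiff_comp_proj (hf : ContMDiff (𝓡 n) 𝓘(ℝ) ∞ f) :
    ContMDiff (𝓡 n).tangent 𝓘(ℝ) ∞ fun q : TangentBundle (𝓡 n) M => f q.1 :=
  hf.comp (contMDiff_proj (TangentSpace (𝓡 n)))

lemma smoothOnSlit_energy (hf : ContMDiff (𝓡 n) 𝓘(ℝ) ∞ f) : SmoothOnSlit (energy g f) := by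
  have h1 : ContMDiff (𝓡 n).tangent 𝓘(ℝ) ∞
      fun q : TangentBundle (𝓡 n) M => Real.exp (-2 * f q.1) :=
    Real.contDiff_exp.contMDiff.comp (contMDiff_const.mul (contMDiff_comp_proj hf))
  exact ((h1.mul (contMDiff_normSq g)).div_const 2).contMDiffOn

/-- The derivatives of the profile of the kinetic energy. -/
lemma fderiv_energyProfile {E : Type*} [NormedAddCommGroup E] [NormedSpace ℝ E]
    {F : E → ℝ} {x : E}
    (hF : ContDiffAt ℝ ∞ F x) (r : ℝ) {P : E × ℝ → ℝ}
    (hP : P = fun y => Real.exp (-2 * F y.1) * y.2 ^ 2 / 2) :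
    ContDiffAt ℝ ∞ P (x, r) ∧
    (∀ ξ, fderiv ℝ P (x, r) (ξ, 0) = -(Real.exp (-2 * F x) * r ^ 2 * fderiv ℝ F x ξ)) ∧
    fderiv ℝ P (x, r) (0, 1) = Real.exp (-2 * F x) * r ∧
    (∀ ξ, fderiv ℝ (fun y => fderiv ℝ P y (0, 1)) (x, r) (ξ, 0) =
      -(2 * Real.exp (-2 * F x) * r * fderiv ℝ F x ξ)) ∧
    fderiv ℝ (fun y => fderiv ℝ P y (0, 1)) (x, r) (0, 1) = Real.exp (-2 * F x) := by
  subst hP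
  have hexp : ∀ z : E × ℝ, DifferentiableAt ℝ F z.1 →
      HasFDerivAt (fun y : E × ℝ => Real.exp (-2 * F y.1)) (Real.exp (-2 * F z.1) •
        ((-2 : ℝ) • (fderiv ℝ F z.1 ∘L ContinuousLinearMap.fst ℝ E ℝ))) z := fun z hz =>
    ((hz.hasFDerivAt.comp z hasFDerivAt_fst).const_mul (-2)).exp
  have hsnd : ∀ z : E × ℝ, HasFDerivAt (fun y : E × ℝ => y.2)
      (ContinuousLinearMap.snd ℝ E ℝ) z := fun z => hasFDerivAt_snd
  have hP1 : ∀ z : E × ℝ, DifferentiableAt ℝ F z.1 → ∀ ξ a,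
      fderiv ℝ (fun y : E × ℝ => Real.exp (-2 * F y.1) * y.2 ^ 2 / 2) z (ξ, a) =
      -(Real.exp (-2 * F z.1) * z.2 ^ 2 * fderiv ℝ F z.1 ξ) + Real.exp (-2 * F z.1) * z.2 * a := by
    intro z hz ξ a
    have h := (((hexp z hz).mul ((hsnd z).mul (hsnd z))).mul_const (1 / 2))
    have h2 : (fun y : E × ℝ => Real.exp (-2 * F y.1) * y.2 ^ 2 / 2) =
        fun y : E × ℝ => Real.exp (-2 * F y.1) * (y.2 * y.2) * (1 / 2) := by
      funext y; ring
    rw [h2]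
    have h3 : fderiv ℝ (fun y : E × ℝ => Real.exp (-2 * F y.1) * (y.2 * y.2) * (1 / 2)) z = _ :=
      h.fderiv
    rw [h3]
    simp only [smul_apply, add_apply, smul_eq_mul, ContinuousLinearMap.comp_apply,
      ContinuousLinearMap.coe_fst', ContinuousLinearMap.coe_snd', Pi.mul_apply]
    ring
  have hd : DifferentiableAt ℝ F x := hF.differentiableAt (by simp)
  have hev : (fun y => fderiv ℝ (fun y : E × ℝ => Real.exp (-2 * F y.1) * y.2 ^ 2 / 2) y (0, 1))
      =ᶠ[𝓝 (x, r)] fun y => Real.exp (-2 * F y.1) * y.2 := by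
    have h1 : ∀ᶠ y in 𝓝 x, DifferentiableAt ℝ F y :=
      ((hF.of_le (m := 1) (by norm_cast)).eventually (by simp)).mono
        fun y hy => hy.differentiableAt (by simp)
    have h2 : ∀ᶠ z : E × ℝ in 𝓝 (x, r), DifferentiableAt ℝ F z.1 :=
      (continuousAt_fst (p := (x, r))).eventually h1
    filter_upwards [h2] with z hz
    rw [hP1 z hz]
    simp
  have h2 : ∀ ξ a, fderiv ℝ (fun y : E × ℝ => Real.exp (-2 * F y.1) * y.2) (x, r) (ξ, a) =
      -(2 * Real.exp (-2 * F x) * r * fderiv ℝ F x ξ) + Real.exp (-2 * F x) * a := by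
    intro ξ a
    have h3 : fderiv ℝ (fun y : E × ℝ => Real.exp (-2 * F y.1) * y.2) (x, r) = _ :=
      ((hexp (x, r) hd).mul (hsnd (x, r))).fderiv
    rw [h3]
    simp only [smul_apply, add_apply, smul_eq_mul, ContinuousLinearMap.comp_apply,
      ContinuousLinearMap.coe_fst', ContinuousLinearMap.coe_snd']
    ring
  refine ⟨?_, fun ξ => ?_, ?_, fun ξ => ?_, ?_⟩
  · have h1 : ContDiffAt ℝ ∞ (fun y : E × ℝ => F y.1) (x, r) :=
      ContDiffAt.comp (x, r) (f := Prod.fst) hF contDiffAt_fst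
    exact (((contDiffAt_const.mul h1).exp).mul (contDiffAt_snd.pow 2)).div_const 2
  · rw [hP1 (x, r) hd]; simp
  · rw [hP1 (x, r) hd]; simp
  · rw [hev.fderiv_eq, h2]; simp
  · rw [hev.fderiv_eq, h2]; simp

/-- The kinetic energy of `e^{-2f} g` is a Lagrange function for the conformal force field. -/
lemma isLagrangeFunction_energy (hf : ContMDiff (𝓡 n) 𝓘(ℝ) ∞ f) :
    IsLagrangeFunction g (conformalForce g f) (energy g f) := by
  have hprof := isProfile_energy g f
  have hfd := fun (p : M) (r : ℝ) =>
    fderiv_energyProfile (contDiffAt_coordFunction hf p (pt_mem_target p)) r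
      (P := coordProfile (fun p r => Real.exp (-2 * f p) * r ^ 2 / 2) p) rfl
  refine ⟨smoothOnSlit_energy g hf, fun p v hv => ?_, fun p v hv k => ?_⟩
  · obtain ⟨hP, hx, hr, hrx, hrr⟩ := hfd p (len g v)
    have hl := (len_pos g p hv).ne'
    have h : velHessian (energy g f) p v =
        Real.exp (-2 * coordFunction f p (pt (n := n) p)) • gramAt g p := by
      ext i j
      rw [hprof.velHessian_eq hv hP, hr, hrr, Matrix.smul_apply, smul_eq_mul]
      field_simp
      ring
    rw [h, Matrix.det_smul]
    exact mul_ne_zero (pow_ne_zero _ (Real.exp_pos _).ne') (isUnit_det_gramAt g p).ne_zero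
  · obtain ⟨hP, hx, hr, hrx, hrr⟩ := hfd p (len g v)
    have hl := (len_pos g p hv).ne'
    rw [hprof.eulerLagrange_eq _ hv hP, hx, hr, hrx, hrr, sum_comp_mul_lower_conformalForce,
      lower_conformalForce, fderiv_coordFunction]
    have h1 : ∑ s, grad f p s * vec v s = ∑ s, grad f p s * comp v s := rfl
    have h2 : fderiv ℝ (coordFunction f p) (pt (n := n) p) (e k) = grad f p k := rfl
    rw [h1, h2]
    field_simp
    ring

/-! ### The field `|v| e^{-f}` -/

lemma isProfile_expField (f : M → ℝ) :
    IsProfile g (expField g f) fun p r => r * Real.exp (-f p) := fun _ _ _ => rfl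

lemma smoothOnSlit_expField (hf : ContMDiff (𝓡 n) 𝓘(ℝ) ∞ f) : SmoothOnSlit (expField g f) := by
  intro q hq
  have h1 : ContMDiffAt (𝓡 n).tangent 𝓘(ℝ) ∞
      (fun q : TangentBundle (𝓡 n) M => Real.exp (-f q.1)) q :=
    (Real.contDiff_exp.contMDiff.comp (contMDiff_comp_proj hf).neg).contMDiffAt
  have h2 : ContMDiffAt (𝓡 n).tangent 𝓘(ℝ) ∞
      (fun q : TangentBundle (𝓡 n) M => √(g.inner q.1 q.2 q.2)) q :=
    ContMDiffAt.comp q (Real.contDiffAt_sqrt (g.pos q.1 q.2 hq).ne').contMDiffAt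
      (contMDiff_normSq g).contMDiffAt
  exact (h2.mul h1).contMDiffWithinAt

lemma radialDeriv_expField (f : M → ℝ) (p : M) {v : TangentSpace (𝓡 n) p} (hv : v ≠ 0) :
    radialDeriv g (expField g f) p v = Real.exp (-f p) := by
  rw [(isProfile_expField g f).radialDeriv_eq hv]
  simp

lemma spatialGrad_expField (hf : ContMDiff (𝓡 n) 𝓘(ℝ) ∞ f) (p : M) {v : TangentSpace (𝓡 n) p}
    (hv : v ≠ 0) (q : Fin n) :
    spatialGrad g (expField g f) p v q = -(len g v * Real.exp (-f p) * grad f p q) := by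
  have hF : DifferentiableAt ℝ (coordFunction f p) (pt (n := n) p) :=
    (contDiffAt_coordFunction hf p (pt_mem_target p)).differentiableAt (by simp)
  have h1 : HasFDerivAt (fun y : 𝔼 × ℝ => coordFunction f p y.1)
      (fderiv ℝ (coordFunction f p) (pt (n := n) p) ∘L ContinuousLinearMap.fst ℝ 𝔼 ℝ)
      (pt (n := n) p, len g v) :=
    HasFDerivAt.comp (pt (n := n) p, len g v) (f := Prod.fst) hF.hasFDerivAt hasFDerivAt_fst
  have h2 : HasFDerivAt (coordProfile (n := n) (fun p r => r * Real.exp (-f p)) p) _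
      (pt (n := n) p, len g v) := hasFDerivAt_snd.mul h1.neg.exp
  rw [(isProfile_expField g f).spatialGrad_eq hv h2.differentiableAt, h2.fderiv]
  simp only [smul_apply, add_apply, neg_apply, smul_eq_mul, ContinuousLinearMap.comp_apply,
    ContinuousLinearMap.coe_fst', ContinuousLinearMap.coe_snd', Pi.neg_apply]
  rw [show coordFunction f p (pt (n := n) p) = f p from congrArg f (extChartAt_to_inv p),
    show fderiv ℝ (coordFunction f p) (pt (n := n) p) (e q) = grad f p q from rfl]
  ring

/-- If `∇W / W'` is `-|v| ∇f`, then the force field of `W` is the conformal one. -/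
lemma shiftForce_eq_conformalForce {W : TangentBundle (𝓡 n) M → ℝ} (f : M → ℝ) (p : M)
    {v : TangentSpace (𝓡 n) p} (hv : v ≠ 0)
    (hb : ∀ s, spatialGrad g W p v s / radialDeriv g W p v = -(len g v * grad f p s)) :
    shiftForce g W p v = conformalForce g f p v := by
  have hl := (len_pos g p hv).ne'
  refine lower_injective g p (funext fun k => ?_)
  simp only [lower_shiftForce g _ p hv, lower_conformalForce, hb]
  have h1 : ∑ s, -(len g v * grad f p s) * comp v s =
      -(len g v * ∑ s, grad f p s * comp v s) := by
    rw [Finset.mul_sum, ← Finset.sum_neg_distrib]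
    exact Finset.sum_congr rfl fun s _ => by ring
  rw [h1]
  field_simp
  ring

lemma shiftForce_expField (hf : ContMDiff (𝓡 n) 𝓘(ℝ) ∞ f) (p : M) {v : TangentSpace (𝓡 n) p}
    (hv : v ≠ 0) : shiftForce g (expField g f) p v = conformalForce g f p v := by
  refine shiftForce_eq_conformalForce g f p hv fun s => ?_
  rw [spatialGrad_expField g hf p hv, radialDeriv_expField g f p hv]
  have := (Real.exp_pos (-f p)).ne'
  field_simp

/-! ### Geodesics of the conformally equivalent metric -/

lemma gram_conformalMetric (hf : ContMDiff (𝓡 n) 𝓘(ℝ) ∞ f) (c : M) (x : 𝔼) (i j : Fin n) :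
    gram (conformalMetric g f hf) c x i j =
      Real.exp (-2 * coordFunction f c x) * gram g c x i j := rfl

lemma formAt_conformalMetric (hf : ContMDiff (𝓡 n) 𝓘(ℝ) ∞ f) (p : M) (v w : 𝔼) :
    formAt (conformalMetric g f hf) p v w =
      Real.exp (-2 * coordFunction f p (pt (n := n) p)) * formAt g p v w := by
  simp only [formAt, form, bilin, gram_conformalMetric, Finset.mul_sum, mul_assoc]

lemma formDeriv_conformalMetric (hf : ContMDiff (𝓡 n) 𝓘(ℝ) ∞ f) (p : M) (u v w : 𝔼) :
    formDeriv (conformalMetric g f hf) p u v w = Real.exp (-2 * coordFunction f p (pt (n := n) p)) *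
      (formDeriv g p u v w
        - 2 * fderiv ℝ (coordFunction f p) (pt (n := n) p) u * formAt g p v w) := by
  have hF : DifferentiableAt ℝ (coordFunction f p) (pt (n := n) p) :=
    (contDiffAt_coordFunction hf p (pt_mem_target p)).differentiableAt (by simp)
  have hd : ∀ i j, fderiv ℝ (fun x => gram (conformalMetric g f hf) p x i j) (pt p) u =
      Real.exp (-2 * coordFunction f p (pt (n := n) p)) *
        (fderiv ℝ (fun x => gram g p x i j) (pt p) u
        - 2 * fderiv ℝ (coordFunction f p) (pt (n := n) p) u * gram g p (pt p) i j) := by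
    intro i j
    have hG := ((contDiffAt_gram g p (pt_mem_target p) i j).differentiableAt
      (by simp)).hasFDerivAt
    have h1 : fderiv ℝ (fun x => gram (conformalMetric g f hf) p x i j) (pt p) = _ :=
      (((hF.hasFDerivAt.const_mul (-2)).exp).mul hG).fderiv
    rw [h1]
    simp only [smul_apply, add_apply, smul_eq_mul]
    ring
  simp only [formDeriv, bilinDeriv, hd, formAt, form, bilin, Finset.mul_sum,
    ← Finset.sum_sub_distrib]
  refine Finset.sum_congr rfl fun i _ => Finset.sum_congr rfl fun j _ => ?_
  ring

/-- The Newtonian vector field of the conformal force field is the geodesic vector field of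
`e^{-2f} g`: both are lowered with `g` and compared. -/
lemma newtonField_conformalForce (hf : ContMDiff (𝓡 n) 𝓘(ℝ) ∞ f) (p : M)
    (v : TangentSpace (𝓡 n) p) : newtonField g (conformalForce g f) p v =
      newtonField (conformalMetric g f hf) (fun _ _ => 0) p v := by
  have hE := Real.exp_pos (-2 * coordFunction f p (pt (n := n) p))
  suffices h : ofVec p (WithLp.toLp 2 (newtonField g (conformalForce g f) p v)) =
      ofVec p (WithLp.toLp 2 (newtonField (conformalMetric g f hf) (fun _ _ => 0) p v)) by
    funext k
    exact congrArg (fun u : TangentSpace (𝓡 n) p => vec u k) h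
  refine lower_injective g p (funext fun m => ?_)
  simp only [lower_eq]
  change formAt g p (WithLp.toLp 2 (newtonField g (conformalForce g f) p v)) (e m) =
    formAt g p (WithLp.toLp 2 (newtonField (conformalMetric g f hf) (fun _ _ => 0) p v)) (e m)
  have h1 := formAt_newtonField g (conformalForce g f) p v m
  have h2 := formAt_newtonField (conformalMetric g f hf) (fun _ _ => 0) p v m
  have h3 : lower (conformalMetric g f hf) (0 : TangentSpace (𝓡 n) p) m = 0 := by
    rw [lower_eq, formAt_e]
    exact Finset.sum_eq_zero fun c _ => mul_zero _
  rw [h3, formAt_conformalMetric, formDeriv_conformalMetric, formDeriv_conformalMetric,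
    fderiv_coordFunction] at h2
  rw [lower_conformalForce, len_sq, lower_eq] at h1
  have h4 : fderiv ℝ (coordFunction f p) (pt (n := n) p) (e m) = grad f p m := rfl
  have h5 : ∑ s, grad f p s * vec v s = ∑ s, grad f p s * comp v s := rfl
  rw [h4, h5] at h2
  refine mul_left_cancel₀ hE.ne' ?_
  rw [h1, h2]
  ring

lemma isTrajectory_conformalForce_iff (hf : ContMDiff (𝓡 n) 𝓘(ℝ) ∞ f) (γ : ℝ → M) (s : Set ℝ) :
    IsTrajectory g (conformalForce g f) γ s ↔ IsGeodesic (conformalMetric g f hf) γ s := by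
  refine and_congr_right fun _ => forall₂_congr fun t _ => forall_congr' fun k => ?_
  have h := congrFun (newtonField_conformalForce g hf (γ t)
    (deriv (fun τ => extChartAt (𝓡 n) (γ t) (γ τ)) t)) k
  -- both equations say that the acceleration is the vertical part of the common vector field
  have key : ∀ {A G F G' : ℝ}, F - G = 0 - G' → (A + G = F ↔ A + G' = 0) := by
    intro A G F G' h
    constructor <;> intro h' <;> linarith
  exact key h

end Conformal

/-! ### The criterion -/

lemma IsProfile.fiberwiseSpherical {g : Metric n M} {X : TangentBundle (𝓡 n) M → ℝ}
    {w : M → ℝ → ℝ} (hw : IsProfile g X w) : FiberwiseSpherical g X := ⟨w, hw⟩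

/-- Necessity: a fiberwise spherically symmetric Lagrange function forces `∇W / W'` to be
`-|v| ∇f` for a globally defined `f`. -/
lemma exists_conformalForce_of_isLagrangeFunction (hn : 2 ≤ n) {g : Metric n M}
    {W L : TangentBundle (𝓡 n) M → ℝ} (hW : SmoothOnSlit W) (hsW : FiberwiseSpherical g W)
    (hW' : ∀ (p : M) (v : TangentSpace (𝓡 n) p), v ≠ 0 → radialDeriv g W p v ≠ 0)
    (hsL : FiberwiseSpherical g L) (hL : IsLagrangeFunction g (shiftForce g W) L) :
    ∃ f : M → ℝ, ContMDiff (𝓡 n) 𝓘(ℝ) ∞ f ∧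
      ∀ (p : M) (v : TangentSpace (𝓡 n) p), v ≠ 0 →
        shiftForce g W p v = conformalForce g f p v := by
  obtain ⟨w, hw⟩ := hsW
  obtain ⟨ℓ, hl⟩ := hsL
  change IsProfile g W w at hw
  have hn0 : 0 < n := by omega
  have hP : ∀ (c : M), ∀ x ∈ (extChartAt (𝓡 n) c).target, ∀ r, 0 < r →
      ContDiffAt ℝ ∞ (coordProfile w c) (x, r) := fun c x hx r hr => hw.contDiffAt hn0 hW c hx hr
  have hne : ∀ p r, 0 < r → deriv (w p) r ≠ 0 := by
    intro p r hr
    have he : (e ⟨0, hn0⟩ : 𝔼) ≠ 0 := by simp [e]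
    obtain ⟨a, -, hlen, hv⟩ := exists_smul_len_eq g p he hr
    have h := hW' p _ hv
    rwa [hw.radialDeriv_eq hv, hlen] at h
  obtain ⟨f, hf, hgrad⟩ := exists_potential hP hne
    fun p k r hr => quotient_linear hn hW hw hL hl p k hr
  refine ⟨f, hf, fun p v hv => shiftForce_eq_conformalForce g f p hv fun s => ?_⟩
  have hr := len_pos g p hv
  rw [hw.spatialGrad_eq hv ((hP p _ (pt_mem_target p) _ hr).differentiableAt (by simp)),
    hw.radialDeriv_eq hv, quotient_linear hn hW hw hL hl p s hr, hgrad]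
  ring

end

end NewtonLagrange

open NewtonLagrange in
theorem theorem8p1 {n : ℕ} (hn : 2 ≤ n) {M : Type*} [TopologicalSpace M]
    [ChartedSpace (EuclideanSpace ℝ (Fin n)) M] [IsManifold (𝓡 n) ∞ M] (g : Metric n M) :
    -- The criterion.
    (∀ W : TangentBundle (𝓡 n) M → ℝ, SmoothOnSlit W → FiberwiseSpherical g W →
      (∀ (p : M) (v : TangentSpace (𝓡 n) p), v ≠ 0 → radialDeriv g W p v ≠ 0) →
      ((∃ L : TangentBundle (𝓡 n) M → ℝ,
          FiberwiseSpherical g L ∧ IsLagrangeFunction g (shiftForce g W) L) ↔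
        ∃ f : M → ℝ, ContMDiff (𝓡 n) 𝓘(ℝ) ∞ f ∧
          ∀ (p : M) (v : TangentSpace (𝓡 n) p), v ≠ 0 →
            shiftForce g W p v = conformalForce g f p v)) ∧
    ∀ (f : M → ℝ) (hf : ContMDiff (𝓡 n) 𝓘(ℝ) ∞ f),
      -- The second kind of force field is the case `W = |v| e^{-f}` of the first.
      (SmoothOnSlit (expField g f) ∧ FiberwiseSpherical g (expField g f) ∧
        ∀ (p : M) (v : TangentSpace (𝓡 n) p), v ≠ 0 →
          radialDeriv g (expField g f) p v ≠ 0 ∧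
          shiftForce g (expField g f) p v = conformalForce g f p v) ∧
      -- Its flow is the geodesic flow of `e^{-2f} g`.
      (∀ (p : M) (v : TangentSpace (𝓡 n) p),
        newtonField g (conformalForce g f) p v =
          newtonField (conformalMetric g f hf) (fun _ _ => 0) p v) ∧
      ∀ (s : Set ℝ), IsOpen s → ∀ γ : ℝ → M,
        (IsTrajectory g (conformalForce g f) γ s ↔ IsGeodesic (conformalMetric g f hf) γ s) := by
  refine ⟨fun W hW hsW hW' => ⟨?_, ?_⟩, fun f hf => ⟨⟨smoothOnSlit_expField g hf,
    (isProfile_expField g f).fiberwiseSpherical,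
    fun p v hv => ⟨?_, shiftForce_expField g hf p hv⟩⟩, ?_, ?_⟩⟩
  · rintro ⟨L, hsL, hL⟩
    exact exists_conformalForce_of_isLagrangeFunction hn hW hsW hW' hsL hL
  · rintro ⟨f, hf, hF⟩
    have h := isLagrangeFunction_energy g hf
    refine ⟨energy g f, (isProfile_energy g f).fiberwiseSpherical, h.smooth, h.regular,
      fun p v hv k => ?_⟩
    have hk := h.euler_lagrange p v hv k
    -- the Euler-Lagrange expression at `v` involves only the value of the force at `v`
    simp only [eulerLagrange, newtonField] at hk ⊢
    rwa [hF p v hv]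
  · rw [radialDeriv_expField g f p hv]
    exact (Real.exp_pos _).ne'
  · exact fun p v => newtonField_conformalForce g hf p v
  · exact fun s _ γ => isTrajectory_conformalForce_iff g hf γ s
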